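/- For a modulus $k\in(0,1)$ let $K(k)=\int_0^{\pi/2}\frac{dt}{\sqrt{1-k^2\sin^2 t}}$ and $E(k)=\int_0^{\pi/2}\sqrt{1-k^2\sin^2 t}\,dt$ be the complete elliptic integrals. For $\kappa\in(0,1)$ let $a=a(\kappa)\in(0,1)$ be the unique solution of $$\kappa=\int_a^1\sqrt{\frac{\mu^2-a^2}{1-\mu^2}}\,d\mu ,$$ put $a'=\sqrt{1-a^2}$ and $$V(\kappa)=-\frac2\pi\Big(E(a)-(1-a^2)K(a)\Big),\quad \tau=\tau(\kappa)=2i\,\frac{K(a)}{K(a')},\quad c=c(\kappa)=\frac{i}{2K(a')},\quad d=-\frac{\tau}{4}.$$ Let $\theta_3(z|\tau)=\sum_{m\in\mathbb Z}e^{i\pi\tau m^2+2\pi i mz}$, $\theta_0(z|\tau)=\theta_3(z+\tfrac12|\tau)$, $\theta_2(z|\tau)=e^{i\pi\tau/4+i\pi z}\theta_3(z+\tfrac\tau2|\tau)$, and let a prime on a theta function or on a quotient of theta functions denote the derivative in $z$. Put $$\Xi_j(x,\kappa)=2\,\frac{\theta_3^2(0|\tau)}{\theta_3^2(x|\tau)}\,\frac{\theta_j(x+d|\tau)\,\theta_j(x-d|\tau)}{\theta_j^2(d|\tau)}\quad(j=0,2),$$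 and, with $L(z)=\theta_0'(z|\tau)/\theta_0(z|\tau)$ and $S(z)=\theta_0''(z|\tau)/\theta_0(z|\tau)$, $$\begin{aligned}\Theta_0(x,\kappa)={}&5c^2\big\{S(x+d)-2L'(d)+S(x-d)\big\}+14c^2L(x-d)L(x+d)\\&-4c^2\big\{L(x-d)+L(d)-L(x+d)\big\}L(d)\\&-2c(1+a)\big\{L(x+d)-2L(d)-L(x-d)\big\}-2(2+a).\end{aligned}$$ Finally let $$M(x,\kappa)=\frac{\Xi_0(x,\kappa)\Theta_0(x,\kappa)+6a\,\Xi_2(x,\kappa)}{48a(1+a)}+\frac{i}{4\pi}\,\frac{\kappa}{\theta_3(x|\tau)}\,\frac{\partial^2\theta_3}{\partial x^2}(x|\tau)\,\frac{d\tau}{d\kappa},\qquad a_0(u)=\int_0^1M(x,u)\,dx .$$ Let $\delta\in(0,1)$ and $s_0>0$. Then the integral defining $a_0(u)$ converges absolutely for every $0<u\le1-\delta$, and there is a constant $C=C(\delta,s_0)$ such that for all $s\ge s_0$ and all $0<v\le s(1-\delta)$, with $\kappa=v/s$, both integrals below converge absolutely and $$\left|\int_s^\infty M\Big(tV\big(\tfrac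 vt\big),\tfrac vt\Big)\frac{dt}{t}-\int_0^{\kappa}a_0(u)\,\frac{du}{u}\right|\le\frac{C}{s}.$$ -/

import Mathlib

open MeasureTheory Set

noncomputable section

namespace SineKernel

/-- Complete elliptic integral of the first kind, as a function of the modulus `k`. -/
def ellipticK (k : ℝ) : ℝ :=
  ∫ t in (0 : ℝ)..(Real.pi / 2), 1 / √(1 - k ^ 2 * Real.sin t ^ 2)

/-- Complete elliptic integral of the second kind, as a function of the modulus `k`. -/
def ellipticE (k : ℝ) : ℝ :=
  ∫ t in (0 : ℝ)..(Real.pi / 2), √(1 - k ^ 2 * Real.sin t ^ 2)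

/-- The integral `∫_a^1 √((μ² - a²) / (1 - μ²)) dμ`. -/
def branchIntegral (a : ℝ) : ℝ :=
  ∫ μ in a..1, √((μ ^ 2 - a ^ 2) / (1 - μ ^ 2))

open Classical in
/-- The branch point `a(κ)`: for `0 < κ < 1`, the unique solution `a ∈ (0,1)` of
`κ = ∫_a^1 √((μ² - a²) / (1 - μ²)) dμ`
(existence and uniqueness are proved in `existsUnique_branchIntegral_eq`). -/
def branchPoint (κ : ℝ) : ℝ :=
  if h : ∃ a : ℝ, a ∈ Ioo (0 : ℝ) 1 ∧ κ = branchIntegral a then h.choose else 0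

/-- The complementary modulus `a' = √(1 - a²)` at `a = a(κ)`. -/
def coBranchPoint (κ : ℝ) : ℝ := √(1 - branchPoint κ ^ 2)

/-- The frequency `V(κ) = -(2/π) (E(a) - (1 - a²) K(a))`. -/
def freqV (κ : ℝ) : ℝ :=
  -(2 / Real.pi) * (ellipticE (branchPoint κ) -
    (1 - branchPoint κ ^ 2) * ellipticK (branchPoint κ))

/-- `τ(κ) = 2 i K(a) / K(a')`. -/
def tau (κ : ℝ) : ℂ :=
  2 * Complex.I * (ellipticK (branchPoint κ) : ℂ) / (ellipticK (coBranchPoint κ) : ℂ)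

/-- `c(κ) = (i / 2) / K(a')`. -/
def normC (κ : ℝ) : ℂ := Complex.I / 2 * (1 / (ellipticK (coBranchPoint κ) : ℂ))

/-- `d = -τ / 4`. -/
def shiftD (κ : ℝ) : ℂ := -(tau κ) / 4

/-- `θ₃(z|τ) = ∑_{m ∈ ℤ} exp(iπτm² + 2πimz)`; this is Mathlib's `jacobiTheta₂`. -/
def theta3 (z τ : ℂ) : ℂ := jacobiTheta₂ z τ

/-- `θ₀(z|τ) = θ₃(z + 1/2|τ)`. -/
def theta0 (z τ : ℂ) : ℂ := theta3 (z + 1 / 2) τ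

/-- `θ₂(z|τ) = exp(iπτ/4 + iπz) θ₃(z + τ/2|τ)`. -/
def theta2 (z τ : ℂ) : ℂ :=
  Complex.exp (Complex.I * Real.pi / 4 * τ + Complex.I * Real.pi * z) * theta3 (z + τ / 2) τ

/-- `Ξ₀(x,κ)`. -/
def Xi0 (x : ℂ) (κ : ℝ) : ℂ :=
  2 * (theta3 0 (tau κ) ^ 2 / theta3 x (tau κ) ^ 2) *
    (theta0 (x + shiftD κ) (tau κ) * theta0 (x - shiftD κ) (tau κ) /
      theta0 (shiftD κ) (tau κ) ^ 2)

/-- `Ξ₂(x,κ)`. -/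
def Xi2 (x : ℂ) (κ : ℝ) : ℂ :=
  2 * (theta3 0 (tau κ) ^ 2 / theta3 x (tau κ) ^ 2) *
    (theta2 (x + shiftD κ) (tau κ) * theta2 (x - shiftD κ) (tau κ) /
      theta2 (shiftD κ) (tau κ) ^ 2)

/-- The quotient `θ₀'(z|τ) / θ₀(z|τ)`, the derivative being with respect to `z`. -/
def logTheta0 (z τ : ℂ) : ℂ := deriv (fun w => theta0 w τ) z / theta0 z τ

/-- The quotient `θ₀''(z|τ) / θ₀(z|τ)`, the derivatives being with respect to `z`. -/
def secTheta0 (z τ : ℂ) : ℂ := iteratedDeriv 2 (fun w => theta0 w τ) z / theta0 z τ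

/-- `Θ₀(x,κ)`. -/
def Theta0 (x : ℂ) (κ : ℝ) : ℂ :=
  let a : ℂ := (branchPoint κ : ℂ)
  let c : ℂ := normC κ
  let τ : ℂ := tau κ
  let d : ℂ := shiftD κ
  5 * c ^ 2 * (secTheta0 (x + d) τ - 2 * deriv (fun w => logTheta0 w τ) d + secTheta0 (x - d) τ)
    + 14 * c ^ 2 * logTheta0 (x - d) τ * logTheta0 (x + d) τ
    - 4 * c ^ 2 * (logTheta0 (x - d) τ + logTheta0 d τ - logTheta0 (x + d) τ) * logTheta0 d τ
    - 2 * c * (1 + a) * (logTheta0 (x + d) τ - 2 * logTheta0 d τ - logTheta0 (x - d) τ)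
    - 2 * (2 + a)

/-- The function `M(x,κ)`. -/
def M (x : ℂ) (κ : ℝ) : ℂ :=
  (Xi0 x κ * Theta0 x κ + 6 * (branchPoint κ : ℂ) * Xi2 x κ) /
      (48 * (branchPoint κ : ℂ) * (1 + (branchPoint κ : ℂ)))
    + Complex.I / (4 * Real.pi) * ((κ : ℂ) / theta3 x (tau κ)) *
      iteratedDeriv 2 (fun y => theta3 y (tau κ)) x * deriv tau κ

/-- The average `a₀(u) = ∫_0^1 M(x,u) dx` over the fast variable. -/
def avgM (u : ℝ) : ℂ := ∫ x in (0 : ℝ)..1, M (x : ℂ) u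

/-! The defining equation of the branch point has exactly one solution in `(0,1)`. -/

lemma intervalIntegrable_weight :
    IntervalIntegrable (fun μ : ℝ => 1 / √(1 - μ ^ 2)) volume 0 1 := by
  have h : IntegrableOn (fun μ : ℝ => 1 / √(1 - μ ^ 2)) (Ioc 0 1) := by
    refine intervalIntegral.integrableOn_deriv_of_nonneg (g := Real.arcsin)
      Real.continuous_arcsin.continuousOn (fun x hx => ?_) (fun x _ => by positivity)
    exact Real.hasDerivAt_arcsin (by linarith [hx.1]) (by linarith [hx.2])
  exact (intervalIntegrable_iff_integrableOn_Ioc_of_le zero_le_one).2 h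

lemma bound_integrand {a μ : ℝ} (hμ : μ ∈ Ioc (0 : ℝ) 1) :
    ‖√((μ ^ 2 - a ^ 2) / (1 - μ ^ 2))‖ ≤ 1 / √(1 - μ ^ 2) := by
  have h1 : (0 : ℝ) ≤ 1 - μ ^ 2 := by nlinarith [hμ.1, hμ.2]
  rw [Real.norm_of_nonneg (Real.sqrt_nonneg _), Real.sqrt_div' _ h1]
  gcongr
  exact Real.sqrt_le_one.2 (by nlinarith [hμ.1, hμ.2, sq_nonneg a])

lemma intervalIntegrable_integrand (a : ℝ) :
    IntervalIntegrable (fun μ : ℝ => √((μ ^ 2 - a ^ 2) / (1 - μ ^ 2))) volume 0 1 := by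
  refine intervalIntegrable_weight.mono_fun'
    (by fun_prop : Measurable _).aestronglyMeasurable ?_
  rw [uIoc_of_le zero_le_one]
  exact (ae_restrict_mem measurableSet_Ioc).mono fun μ hμ => bound_integrand hμ

lemma branchIntegral_eq {a : ℝ} (ha : a ∈ Icc (0 : ℝ) 1) :
    branchIntegral a = ∫ μ in (0 : ℝ)..1, √((μ ^ 2 - a ^ 2) / (1 - μ ^ 2)) := by
  have hI := intervalIntegrable_integrand a
  have ha' : a ∈ uIcc (0 : ℝ) 1 := by rwa [uIcc_of_le zero_le_one]
  rw [branchIntegral, ← intervalIntegral.integral_add_adjacent_intervals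
    (hI.mono_set (uIcc_subset_uIcc_left ha')) (hI.mono_set (uIcc_subset_uIcc_right ha'))]
  refine (add_eq_right.2 (intervalIntegral.integral_zero_ae ?_)).symm
  refine Filter.Eventually.of_forall fun μ hμ => ?_
  rw [uIoc_of_le ha.1] at hμ
  refine Real.sqrt_eq_zero_of_nonpos (div_nonpos_of_nonpos_of_nonneg ?_ ?_)
  · nlinarith [hμ.1, hμ.2]
  · nlinarith [hμ.1, hμ.2, ha.2]

lemma continuousOn_branchIntegral : ContinuousOn branchIntegral (Icc 0 1) := by
  refine ContinuousOn.congr (Continuous.continuousOn ?_) fun a ha => branchIntegral_eq ha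
  refine intervalIntegral.continuous_of_dominated_interval
    (bound := fun μ => 1 / √(1 - μ ^ 2))
    (fun a => (by fun_prop : Measurable _).aestronglyMeasurable)
    (fun a => Filter.Eventually.of_forall fun μ hμ => ?_) intervalIntegrable_weight
    (Filter.Eventually.of_forall fun μ _ => by fun_prop)
  rw [uIoc_of_le zero_le_one] at hμ
  exact bound_integrand hμ

lemma branchIntegral_one : branchIntegral 1 = 0 := by simp [branchIntegral]

lemma branchIntegral_zero : branchIntegral 0 = 1 := by
  have h : ∫ μ in (0 : ℝ)..1, √((μ ^ 2 - 0 ^ 2) / (1 - μ ^ 2)) =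
      -√(1 - (1 : ℝ) ^ 2) - -√(1 - (0 : ℝ) ^ 2) := by
    refine intervalIntegral.integral_eq_sub_of_hasDerivAt_of_le (f := fun μ => -√(1 - μ ^ 2))
      zero_le_one (by fun_prop) (fun μ hμ => ?_) (intervalIntegrable_integrand 0)
    have h1 : (0 : ℝ) < 1 - μ ^ 2 := by nlinarith [hμ.1, hμ.2]
    have h2 : HasDerivAt (fun μ : ℝ => 1 - μ ^ 2) (-(2 * μ)) μ := by
      simpa using (hasDerivAt_pow 2 μ).const_sub 1
    refine (h2.sqrt h1.ne').fun_neg.congr_deriv ?_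
    rw [Real.sqrt_div' _ h1.le, zero_pow two_ne_zero, sub_zero, Real.sqrt_sq hμ.1.le]
    have := (Real.sqrt_pos.2 h1).ne'
    field_simp
  rw [branchIntegral, h]
  simp

lemma strictAntiOn_branchIntegral : StrictAntiOn branchIntegral (Icc 0 1) := by
  intro a ha b hb hab
  rw [branchIntegral_eq ha, branchIntegral_eq hb]
  refine intervalIntegral.integral_lt_integral_of_ae_le_of_measure_setOfPred_lt_ne_zero zero_le_one
    (intervalIntegrable_integrand b) (intervalIntegrable_integrand a) ?_ ?_
  · refine (ae_restrict_mem measurableSet_Ioc).mono fun μ hμ => ?_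
    have h1 : (0 : ℝ) ≤ 1 - μ ^ 2 := by nlinarith [hμ.1, hμ.2]
    have h2 : a ^ 2 ≤ b ^ 2 := by nlinarith [ha.1]
    exact Real.sqrt_le_sqrt (by gcongr)
  · refine ne_of_gt (lt_of_lt_of_le ?_ (measure_mono (s := Ioo a b) ?_))
    · rw [Measure.restrict_apply measurableSet_Ioo, inter_eq_left.2, Real.volume_Ioo]
      · simpa using hab
      · exact fun x hx => ⟨lt_of_le_of_lt ha.1 hx.1, hx.2.le.trans hb.2⟩
    · intro μ hμ
      have h1 : (0 : ℝ) < 1 - μ ^ 2 := by nlinarith [hμ.1, hμ.2, ha.1, hb.2]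
      have h2 : (μ ^ 2 - b ^ 2) / (1 - μ ^ 2) ≤ 0 :=
        div_nonpos_of_nonpos_of_nonneg (by nlinarith [hμ.1, hμ.2, ha.1]) h1.le
      have h3 : 0 < (μ ^ 2 - a ^ 2) / (1 - μ ^ 2) :=
        div_pos (by nlinarith [hμ.1, hμ.2, ha.1]) h1
      change √((μ ^ 2 - b ^ 2) / (1 - μ ^ 2)) < √((μ ^ 2 - a ^ 2) / (1 - μ ^ 2))
      rw [Real.sqrt_eq_zero_of_nonpos h2]
      exact Real.sqrt_pos.2 h3

theorem existsUnique_branchIntegral_eq {κ : ℝ} (hκ : κ ∈ Ioo (0 : ℝ) 1) :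
    ∃! a : ℝ, a ∈ Ioo (0 : ℝ) 1 ∧ κ = branchIntegral a := by
  have h := intermediate_value_Ioo' zero_le_one continuousOn_branchIntegral
  rw [branchIntegral_zero, branchIntegral_one] at h
  obtain ⟨a, ha, hak⟩ := h hκ
  refine ⟨a, ⟨ha, hak.symm⟩, fun b hb => ?_⟩
  exact strictAntiOn_branchIntegral.injOn (Ioo_subset_Icc_self hb.1) (Ioo_subset_Icc_self ha)
    (by rw [← hb.2, hak])

theorem branchPoint_spec {κ : ℝ} (hκ : κ ∈ Ioo (0 : ℝ) 1) :
    branchPoint κ ∈ Ioo (0 : ℝ) 1 ∧ κ = branchIntegral (branchPoint κ) := by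
  have h := (existsUnique_branchIntegral_eq hκ).exists
  rw [branchPoint, dif_pos h]
  exact h.choose_spec

end SineKernel

end

/-! This is averaging over a fast phase. Put `X(t) = t V(v/t)` and `u = v/t`. Then `X'(t) = V(u) - u
V'(u)`, and Legendre's relation turns this Wronskian into `-1/K(a')` (`freqV_sub_mul_deriv`), so the
phase never stalls while `u` varies slowly. Subtract from `M` its mean over a period in `x`: the
difference is `∂N/∂x` for a bounded corrector `N`. Up to terms of order `t⁻²`, `(M - a₀)/t` is then
the derivative of `-(K(a')/t) N(X(t), u)`. Integrating over `(s, ∞)` leaves a boundary term and a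
remainder, both `O(1/s)`; `u = v/t` turns the integral of the mean into the one in the statement.
This is `exists_averaging_bound`, valid for any periodic `C¹` amplitude with suitable bounds.

What remains is to bound `M` and `u ∂M/∂u` uniformly as `u → 0`, where `a → 1` and `τ → i∞`. The
device is to treat `M` as a function `ampl` of three variables: the phase `x`, the nome `p =
e^{iπτ/2}`, and `m = 1 - a²`. All theta functions at the arguments that occur are power series in
`p` with zero-free sums for `0 ≤ p < 1`, and the elliptic integrals are smooth for `m < 1`. Hence
`ampl` is `C¹` up to and including `p = m = 0` (`contDiffAt_ampl`), where it vanishes (`ampl_zero`).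
So `M = O(p + m)` uniformly in `x`.

Finally `κ = m B(m)` gives `m = O(κ)`. The logarithmic derivative `κ p'/p` depends on `m` alone and
is continuous and positive, so `p = O(κ^ε)` for some `ε > 0` (`nome_le_rpow`). This decay makes both
integrals converge. -/

noncomputable section

namespace SineKernel

open Filter Topology

/-! ### Averaging over a fast phase. -/

/-- Differentiation under the integral sign for the translates of a `C¹` function. -/
lemma hasFDerivAt_integral_translate {g : ℝ × ℝ → ℂ} {U : Set ℝ} (hU : IsOpen U)
    (hg : ∀ x : ℝ, ∀ u ∈ U, ContDiffAt ℝ 1 g (x, u)) {w : ℝ → ℝ} (hw : Continuous w)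
    (x : ℝ) {u : ℝ} (hu : u ∈ U) :
    HasFDerivAt (fun q : ℝ × ℝ => ∫ y in (0 : ℝ)..1, w y • g (q.1 + y, q.2))
      (∫ y in (0 : ℝ)..1, w y • fderiv ℝ g (x + y, u)) (x, u) := by
  obtain ⟨r, hr, hrU⟩ := Metric.nhds_basis_closedBall.mem_iff.1 (hU.mem_nhds hu)
  have hgc : ∀ q : ℝ × ℝ, q.2 ∈ U → ContinuousAt g q := fun q hq => (hg q.1 q.2 hq).continuousAt
  have hdc : ∀ q : ℝ × ℝ, q.2 ∈ U → ContinuousAt (fderiv ℝ g) q :=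
    fun q hq => (hg q.1 q.2 hq).continuousAt_fderiv one_ne_zero
  -- The extra unit of length makes room for the translation by `y ∈ [0, 1]`.
  have hcomp : IsCompact (Icc (x - r) (x + r + 1) ×ˢ Metric.closedBall u r) :=
    isCompact_Icc.prod (isCompact_closedBall u r)
  obtain ⟨C, hC⟩ := hcomp.exists_bound_of_continuousOn (f := fderiv ℝ g)
    (fun q hq => (hdc q (hrU hq.2)).continuousWithinAt)
  have hline : ∀ q : ℝ × ℝ, q.2 ∈ U → Continuous fun y : ℝ => w y • g (q.1 + y, q.2) := by
    intro q hq
    refine hw.smul (continuous_iff_continuousAt.2 fun y => ?_)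
    exact ContinuousAt.comp (f := fun y : ℝ => (q.1 + y, q.2)) (hgc (q.1 + y, q.2) hq) (by fun_prop)
  have hline' : Continuous fun y : ℝ => w y • fderiv ℝ g (x + y, u) := by
    refine hw.smul (continuous_iff_continuousAt.2 fun y => ?_)
    exact ContinuousAt.comp (f := fun y : ℝ => (x + y, u)) (hdc (x + y, u) hu) (by fun_prop)
  refine intervalIntegral.hasFDerivAt_integral_of_dominated_of_fderiv_le
    (s := Metric.closedBall (x, u) r) (bound := fun y => |w y| * C)
    (F' := fun q y => w y • fderiv ℝ g (q.1 + y, q.2))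
    (Metric.closedBall_mem_nhds _ hr) ?_ ?_ ?_ ?_ ?_ ?_
  · filter_upwards [Metric.closedBall_mem_nhds (x, u) hr] with q hq
    rw [← closedBall_prod_same] at hq
    exact (hline q (hrU hq.2)).aestronglyMeasurable
  · exact (hline (x, u) hu).intervalIntegrable _ _
  · exact hline'.aestronglyMeasurable
  · refine Eventually.of_forall fun y hy q hq => ?_
    rw [uIoc_of_le zero_le_one] at hy
    rw [← closedBall_prod_same] at hq
    rw [norm_smul, Real.norm_eq_abs]
    have h1 := hq.1
    rw [Real.closedBall_eq_Icc] at h1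
    refine mul_le_mul_of_nonneg_left (hC (q.1 + y, q.2) ⟨⟨?_, ?_⟩, hq.2⟩) (abs_nonneg _)
    · simp only; linarith [h1.1, hy.1]
    · simp only; linarith [h1.2, hy.2]
  · exact (hw.abs.mul continuous_const).intervalIntegrable _ _
  · refine Eventually.of_forall fun y hy q hq => ?_
    rw [← closedBall_prod_same] at hq
    have h1 : HasFDerivAt g (fderiv ℝ g (q.1 + y, q.2)) (q + (y, 0)) := by
      rw [show q + (y, 0) = (q.1 + y, q.2) by ext <;> simp]
      exact ((hg (q.1 + y) q.2 (hrU hq.2)).differentiableAt one_ne_zero).hasFDerivAt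
    have h2 := (h1.comp q ((hasFDerivAt_id q).add_const (y, 0))).const_smul (w y)
    refine (h2.congr_fderiv ?_).congr_of_eventuallyEq (Eventually.of_forall fun q' => ?_)
    · ext <;> simp
    · simp only [Function.comp, id, Pi.smul_apply]
      congr 2
      ext <;> simp

/-- For a `1`-periodic function, integration by parts of the derivative against the identity
subtracts the mean. -/
lemma integral_mul_deriv_periodic {f f' : ℝ → ℂ} (hf : ∀ x, HasDerivAt f (f' x) x)
    (hf' : Continuous f') (hper : Function.Periodic f 1) (x : ℝ) :
    ∫ y in (0 : ℝ)..1, y • f' (x + y) = f x - ∫ y in (0 : ℝ)..1, f y := by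
  have h1 : ∀ y ∈ uIcc (0 : ℝ) 1, HasDerivAt (fun y => f (x + y)) (f' (x + y)) y := fun y _ => by
    simpa using (hf (x + y)).comp_const_add x y
  have h2 : ∀ y ∈ uIcc (0 : ℝ) 1, HasDerivAt (fun y : ℝ => y) 1 y := fun y _ => hasDerivAt_id y
  have h3 := intervalIntegral.integral_smul_deriv_eq_deriv_smul h2 h1
    (continuous_const.intervalIntegrable _ _)
    (Continuous.intervalIntegrable (by fun_prop) _ _)
  have h4 : ∫ y in (0 : ℝ)..1, f (x + y) = ∫ y in (0 : ℝ)..1, f y := by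
    rw [intervalIntegral.integral_comp_add_left (fun y => f y)]
    have := hper.intervalIntegral_add_eq x 0
    simpa using this
  rw [h3]
  simp only [one_smul, zero_smul, sub_zero, h4, hper x]

/-- Any positive power of `v/t` compensates the logarithmic divergence of `∫ dt/t`; this serves both
for `M` along the orbit and for its mean. -/
lemma integrableOn_div_rpow_bound {F : ℝ → ℂ} {s v A ε : ℝ} (hs : 0 < s) (hv : 0 < v) (hε : 0 < ε)
    (hF : ContinuousOn F (Ioi s)) (hb : ∀ t ∈ Ioi s, ‖F t‖ ≤ A * (v / t) ^ ε) :
    IntegrableOn (fun t : ℝ => F t / (t : ℂ)) (Ioi s) := by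
  have h1 : IntegrableOn (fun t : ℝ => A * v ^ ε * t ^ (-ε - 1)) (Ioi s) :=
    (integrableOn_Ioi_rpow_of_lt (by linarith) hs).const_mul _
  refine Integrable.mono' h1 ?_ ?_
  · refine ContinuousOn.aestronglyMeasurable (hF.div (by fun_prop) fun t ht => ?_)
      measurableSet_Ioi
    have : (0 : ℝ) < t := hs.trans ht
    exact_mod_cast this.ne'
  · refine (ae_restrict_mem measurableSet_Ioi).mono fun t ht => ?_
    have ht0 : (0 : ℝ) < t := hs.trans ht
    rw [norm_div, Complex.norm_real, Real.norm_of_nonneg ht0.le, div_le_iff₀ ht0]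
    refine (hb t ht).trans (le_of_eq ?_)
    rw [Real.div_rpow hv.le ht0.le, Real.rpow_sub ht0, Real.rpow_neg ht0.le, Real.rpow_one]
    field_simp

/-- The substitution `u = v / t`. -/
lemma integral_comp_div_div {s v : ℝ} (hs : 0 < s) (hv : 0 < v) (f : ℝ → ℂ) :
    (IntervalIntegrable (fun u : ℝ => f u / (u : ℂ)) volume 0 (v / s) ↔
      IntegrableOn (fun t : ℝ => f (v / t) / (t : ℂ)) (Ioi s)) ∧
    ∫ u in (0 : ℝ)..(v / s), f u / (u : ℂ) = ∫ t in Ioi s, f (v / t) / (t : ℂ) := by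
  have himg : (fun t : ℝ => v / t) '' Ioi s = Ioo 0 (v / s) := by
    ext u
    constructor
    · rintro ⟨t, ht, rfl⟩
      have ht0 : (0 : ℝ) < t := hs.trans ht
      exact ⟨by positivity, div_lt_div_of_pos_left hv hs ht⟩
    · intro hu
      refine ⟨v / u, ?_, ?_⟩
      · have := hu.2
        rw [lt_div_iff₀ hs] at this
        rw [mem_Ioi, lt_div_iff₀ hu.1]
        linarith
      · have := hu.1.ne'
        have := hv.ne'
        field_simp
  have hinj : InjOn (fun t : ℝ => v / t) (Ioi s) := by
    intro a ha b hb hab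
    have ha0 : (0 : ℝ) < a := hs.trans ha
    have hb0 : (0 : ℝ) < b := hs.trans hb
    have hv' := hv.ne'
    simp only at hab
    field_simp at hab
    exact hab.symm
  have hder : ∀ t ∈ Ioi s, HasDerivWithinAt (fun t : ℝ => v / t) (-(v / t ^ 2)) (Ioi s) t := by
    intro t ht
    have ht0 : t ≠ 0 := (hs.trans ht).ne'
    refine HasDerivAt.hasDerivWithinAt ?_
    refine ((hasDerivAt_inv ht0).const_mul v).congr_deriv ?_
    field_simp
  -- The measure `du/u` is invariant under `u = v/t`.
  have hcongr : ∀ t ∈ Ioi s, |-(v / t ^ 2)| • (f (v / t) / ((v / t : ℝ) : ℂ)) =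
      f (v / t) / (t : ℂ) := by
    intro t ht
    have ht0 : (0 : ℝ) < t := hs.trans ht
    have ht1 : (t : ℂ) ≠ 0 := by exact_mod_cast ht0.ne'
    have hv1 : (v : ℂ) ≠ 0 := by exact_mod_cast hv.ne'
    rw [abs_neg, abs_of_nonneg (by positivity), Complex.real_smul]
    push_cast
    field_simp
  have hvs : 0 ≤ v / s := by positivity
  constructor
  · rw [intervalIntegrable_iff_integrableOn_Ioo_of_le hvs, ← himg,
      integrableOn_image_iff_integrableOn_abs_deriv_smul measurableSet_Ioi hder hinj]
    exact integrableOn_congr_fun hcongr measurableSet_Ioi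
  · rw [intervalIntegral.integral_of_le hvs, integral_Ioc_eq_integral_Ioo, ← himg,
      integral_image_eq_integral_abs_deriv_smul measurableSet_Ioi hder hinj]
    exact setIntegral_congr_fun measurableSet_Ioi hcongr

/-- Averaging over a fast phase: if `X(t) = t V(v / t)` moves with speed `-1 / k(v / t)`, the
integral of `M(X(t), v / t) / t` over `(s, ∞)` agrees with that of the mean up to `O(1 / s)`. -/
theorem exists_averaging_bound {M : ℝ → ℝ → ℂ} {b : ℝ}
    (hM : ∀ x : ℝ, ∀ u ∈ Ioo 0 b, ContDiffAt ℝ 1 (Function.uncurry M) (x, u))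
    (hper : ∀ u ∈ Ioo 0 b, Function.Periodic (fun x => M x u) 1)
    {A ε : ℝ} (hA : 0 ≤ A) (hε : 0 < ε)
    (hMb : ∀ x : ℝ, ∀ u ∈ Ioo 0 b, ‖M x u‖ ≤ A * u ^ ε)
    (hMu : ∀ x : ℝ, ∀ u ∈ Ioo 0 b, ‖u • fderiv ℝ (Function.uncurry M) (x, u) (0, 1)‖ ≤ A)
    {k k' V V' : ℝ → ℝ} (hk : ∀ u ∈ Ioo 0 b, HasDerivAt k (k' u) u)
    (hk0 : ∀ u ∈ Ioo 0 b, 0 < k u) (hkA : ∀ u ∈ Ioo 0 b, k u ≤ A)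
    (hkA' : ∀ u ∈ Ioo 0 b, |u * k' u| ≤ A)
    (hV : ∀ u ∈ Ioo 0 b, HasDerivAt V (V' u) u)
    (hVk : ∀ u ∈ Ioo 0 b, V u - u * V' u = -(1 / k u)) :
    ∃ C : ℝ, ∀ s v : ℝ, 0 < s → 0 < v → v / s < b →
      IntegrableOn (fun t : ℝ => M (t * V (v / t)) (v / t) / (t : ℂ)) (Ioi s) ∧
      IntervalIntegrable (fun u : ℝ => (∫ x in (0 : ℝ)..1, M x u) / (u : ℂ)) volume 0 (v / s) ∧
      ‖(∫ t in Ioi s, M (t * V (v / t)) (v / t) / (t : ℂ)) -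
        ∫ u in (0 : ℝ)..(v / s), (∫ x in (0 : ℝ)..1, M x u) / (u : ℂ)‖ ≤ C / s := by
  set g : ℝ × ℝ → ℂ := Function.uncurry M with hg
  set avg : ℝ → ℂ := fun u => ∫ x in (0 : ℝ)..1, M x u with havg
  -- The corrector: by `integral_mul_deriv_periodic` its `x`-derivative is `M` minus the mean. `J`
  -- is its `u`-derivative.
  set N : ℝ × ℝ → ℂ := fun q => ∫ y in (0 : ℝ)..1, y • g (q.1 + y, q.2) with hN
  set J : ℝ × ℝ → ℂ := fun q => ∫ y in (0 : ℝ)..1, y • fderiv ℝ g (q.1 + y, q.2) (0, 1) with hJ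
  have hdc : ∀ q : ℝ × ℝ, q.2 ∈ Ioo 0 b → ContinuousAt (fderiv ℝ g) q :=
    fun q hq => (hM q.1 q.2 hq).continuousAt_fderiv one_ne_zero
  have hline' : ∀ x : ℝ, ∀ u ∈ Ioo 0 b, Continuous fun y : ℝ => fderiv ℝ g (x + y, u) := by
    refine fun x u hu => continuous_iff_continuousAt.2 fun y => ?_
    exact ContinuousAt.comp (f := fun y : ℝ => (x + y, u)) (hdc (x + y, u) hu) (by fun_prop)
  -- the derivative of the corrector
  have hND : ∀ x : ℝ, ∀ u ∈ Ioo 0 b, ∃ D : ℝ × ℝ →L[ℝ] ℂ, HasFDerivAt N D (x, u) ∧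
      ∀ c e : ℝ, D (c, e) = c • (M x u - avg u) + e • J (x, u) := by
    intro x u hu
    refine ⟨_, hasFDerivAt_integral_translate isOpen_Ioo hM continuous_id x hu, fun c e => ?_⟩
    have hint : Continuous fun y : ℝ => id y • fderiv ℝ g (x + y, u) :=
      continuous_id.smul (hline' x u hu)
    have hsplit : ((c, e) : ℝ × ℝ) = c • ((1, 0) : ℝ × ℝ) + e • ((0, 1) : ℝ × ℝ) := by simp
    rw [hsplit, map_add, map_smul, map_smul,
      ContinuousLinearMap.intervalIntegral_apply (hint.intervalIntegrable _ _),
      ContinuousLinearMap.intervalIntegral_apply (hint.intervalIntegrable _ _)]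
    congr 2
    refine integral_mul_deriv_periodic (f := fun x => M x u)
      (f' := fun x => fderiv ℝ g (x, u) (1, 0)) (fun z => ?_) ?_ (hper u hu) x
    · have h1 : HasFDerivAt g (fderiv ℝ g (z, u)) (z, u) :=
        ((hM z u hu).differentiableAt one_ne_zero).hasFDerivAt
      exact h1.comp_hasDerivAt z ((hasDerivAt_id z).prodMk (hasDerivAt_const z u))
    · have := hline' 0 u hu
      simp only [zero_add] at this
      exact this.clm_apply continuous_const
  have havgc : ∀ u ∈ Ioo 0 b, ContinuousAt avg u := by
    intro u hu
    have h1 := (hasFDerivAt_integral_translate isOpen_Ioo hM (continuous_const (y := (1 : ℝ)))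
      0 hu).continuousAt
    have h2 := ContinuousAt.comp (f := fun u : ℝ => ((0 : ℝ), u)) (x := u) h1 (by fun_prop)
    simpa [Function.comp_def, hg, havg] using h2
  have havgb : ∀ u ∈ Ioo 0 b, ‖avg u‖ ≤ A * u ^ ε := by
    intro u hu
    simpa using intervalIntegral.norm_integral_le_of_norm_le_const (a := (0 : ℝ)) (b := 1)
      (f := fun x => M x u) (fun x _ => hMb x u hu)
  -- An upper bound for `A u^ε` on `0 < u < b`.
  set A₁ : ℝ := A * b ^ ε
  have hNb : ∀ x : ℝ, ∀ u ∈ Ioo 0 b, ‖N (x, u)‖ ≤ A₁ := by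
    intro x u hu
    have := intervalIntegral.norm_integral_le_of_norm_le_const (a := (0 : ℝ)) (b := 1)
      (f := fun y => y • g (x + y, u)) (C := A₁) (fun y hy => ?_)
    · rwa [sub_zero, abs_one, mul_one] at this
    · rw [uIoc_of_le zero_le_one] at hy
      rw [norm_smul, Real.norm_of_nonneg hy.1.le]
      have h1 : ‖g (x + y, u)‖ ≤ A₁ := (hMb (x + y) u hu).trans
        (mul_le_mul_of_nonneg_left (Real.rpow_le_rpow hu.1.le hu.2.le hε.le) hA)
      nlinarith [norm_nonneg (g (x + y, u)), hy.1, hy.2]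
  have hJb : ∀ x : ℝ, ∀ u ∈ Ioo 0 b, ‖u • J (x, u)‖ ≤ A := by
    intro x u hu
    rw [hJ, ← intervalIntegral.integral_smul]
    have := intervalIntegral.norm_integral_le_of_norm_le_const (a := (0 : ℝ)) (b := 1)
      (f := fun y => u • y • fderiv ℝ g (x + y, u) (0, 1)) (C := A) (fun y hy => ?_)
    · simpa using this
    · rw [uIoc_of_le zero_le_one] at hy
      rw [smul_comm, norm_smul, Real.norm_of_nonneg hy.1.le]
      nlinarith [norm_nonneg (u • fderiv ℝ g (x + y, u) (0, 1)), hMu (x + y) u hu, hy.1, hy.2]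
  -- The bracket bounds `t² ‖R t‖` and `A * A₁` bounds the boundary term `s ‖Y s‖`; the factor `2`
  -- is slack.
  refine ⟨2 * (A * A + A₁ * (A + A)) + A * A₁, fun s v hs hv hvs => ?_⟩
  have hmem : ∀ t ∈ Ici s, v / t ∈ Ioo 0 b := fun t ht =>
    ⟨div_pos hv (hs.trans_le ht), (div_le_div_of_nonneg_left hv.le hs ht).trans_lt hvs⟩
  have hmem' : ∀ t ∈ Ioi s, v / t ∈ Ioo 0 b := fun t ht => hmem t (mem_Ici_of_Ioi ht)
  have hpos : ∀ t ∈ Ici s, 0 < t := fun t ht => hs.trans_le ht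
  have hu : ∀ t ∈ Ici s, HasDerivAt (fun t => v / t) (-(v / t / t)) t := by
    intro t ht
    have ht0 := (hpos t ht).ne'
    refine ((hasDerivAt_inv ht0).const_mul v).congr_deriv ?_
    field_simp
  have hX : ∀ t ∈ Ici s, HasDerivAt (fun t => t * V (v / t)) (-(1 / k (v / t))) t := by
    intro t ht
    have ht0 := (hpos t ht).ne'
    refine ((hasDerivAt_id t).mul ((hV _ (hmem t ht)).comp t (hu t ht))).congr_deriv ?_
    rw [← hVk _ (hmem t ht)]
    simp only [id, Function.comp]
    field_simp
    ring
  set F : ℝ → ℂ := fun t => M (t * V (v / t)) (v / t) with hF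
  have hFc : ContinuousOn F (Ioi s) := by
    intro t ht
    have ht' := mem_Ici_of_Ioi ht
    have h1 := (hM (t * V (v / t)) (v / t) (hmem t ht')).continuousAt
    exact (ContinuousAt.comp (f := fun t => (t * V (v / t), v / t)) h1
      ((hX t ht').continuousAt.prodMk (hu t ht').continuousAt)).continuousWithinAt
  have havc : ContinuousOn (fun t => avg (v / t)) (Ioi s) := fun t ht =>
    (ContinuousAt.comp (f := fun t => v / t) (havgc _ (hmem' t ht))
      (hu t (mem_Ici_of_Ioi ht)).continuousAt).continuousWithinAt
  have hI1 : IntegrableOn (fun t : ℝ => F t / (t : ℂ)) (Ioi s) :=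
    integrableOn_div_rpow_bound hs hv hε hFc fun t ht => hMb _ _ (hmem' t ht)
  have hI2 : IntegrableOn (fun t : ℝ => avg (v / t) / (t : ℂ)) (Ioi s) :=
    integrableOn_div_rpow_bound hs hv hε havc fun t ht => havgb _ (hmem' t ht)
  obtain ⟨hsub1, hsub2⟩ := integral_comp_div_div hs hv avg
  refine ⟨hI1, hsub1.2 hI2, ?_⟩
  rw [hsub2, ← integral_sub hI1 hI2]
  -- the primitive of the oscillating part
  set Y : ℝ → ℂ := fun t => (k (v / t) / t) • N (t * V (v / t), v / t) with hY
  set R : ℝ → ℂ := fun t => (-(k (v / t) / t ^ 2)) • ((v / t) • J (t * V (v / t), v / t)) +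
    (-((v / t * k' (v / t) + k (v / t)) / t ^ 2)) • N (t * V (v / t), v / t) with hR
  have hYD : ∀ t ∈ Ici s, HasDerivAt Y (R t - (F t / (t : ℂ) - avg (v / t) / (t : ℂ))) t := by
    intro t ht
    have ht0 := (hpos t ht).ne'
    have htc : (t : ℂ) ≠ 0 := by exact_mod_cast ht0
    have hkc : (k (v / t) : ℂ) ≠ 0 := by exact_mod_cast (hk0 _ (hmem t ht)).ne'
    obtain ⟨D, hD, hDe⟩ := hND (t * V (v / t)) (v / t) (hmem t ht)
    have h1 := hD.comp_hasDerivAt t ((hX t ht).prodMk (hu t ht))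
    have h2 := (((hk _ (hmem t ht)).comp t (hu t ht)).div (hasDerivAt_id t) ht0).smul h1
    refine h2.congr_deriv ?_
    rw [hDe, hR, hF]
    simp only [Function.comp, id, Pi.div_apply, Complex.real_smul]
    push_cast
    field_simp
    ring
  have hRb : ∀ t ∈ Ioi s, ‖R t‖ ≤ (A * A + A₁ * (A + A)) * t ^ (-2 : ℝ) := by
    intro t ht
    have ht0 := hpos t (mem_Ici_of_Ioi ht)
    have hm := hmem' t ht
    rw [Real.rpow_neg ht0.le, Real.rpow_two, ← div_eq_mul_inv, add_div]
    refine (norm_add_le _ _).trans (add_le_add ?_ ?_)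
    · rw [norm_smul, norm_neg, Real.norm_of_nonneg (div_nonneg (hk0 _ hm).le (by positivity)),
        div_mul_eq_mul_div]
      have := hJb (t * V (v / t)) _ hm
      have := hkA _ hm
      gcongr
    · rw [norm_smul, norm_neg, norm_div, Real.norm_of_nonneg (by positivity : 0 ≤ t ^ 2),
        div_mul_eq_mul_div, mul_comm A₁]
      have h1 := hNb (t * V (v / t)) _ hm
      have h2 : ‖v / t * k' (v / t) + k (v / t)‖ ≤ A + A :=
        (norm_add_le _ _).trans (add_le_add (hkA' _ hm)
          (by rw [Real.norm_of_nonneg (hk0 _ hm).le]; exact hkA _ hm))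
      gcongr
  have hI : IntegrableOn (fun t : ℝ => F t / (t : ℂ) - avg (v / t) / (t : ℂ)) (Ioi s) :=
    hI1.sub hI2
  have hbint : IntegrableOn (fun t : ℝ => (A * A + A₁ * (A + A)) * t ^ (-2 : ℝ)) (Ioi s) :=
    (integrableOn_Ioi_rpow_of_lt (by norm_num) hs).const_mul _
  have hRI : IntegrableOn R (Ioi s) := by
    refine Integrable.mono' hbint ?_ ((ae_restrict_mem measurableSet_Ioi).mono hRb)
    -- Measurability of `R` comes for free from that of a derivative, with no study of `J`.
    have h1 : AEStronglyMeasurable (fun t => deriv Y t + (F t / (t : ℂ) - avg (v / t) / (t : ℂ)))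
        (volume.restrict (Ioi s)) :=
      (aestronglyMeasurable_deriv Y _).add hI.aestronglyMeasurable
    refine h1.congr ((ae_restrict_mem measurableSet_Ioi).mono fun t ht => ?_)
    simp only
    rw [(hYD t (mem_Ici_of_Ioi ht)).deriv, sub_add_cancel]
  have hYb : ∀ t ∈ Ici s, ‖Y t‖ ≤ A * A₁ / t := by
    intro t ht
    have ht0 := hpos t ht
    rw [hY, norm_smul, Real.norm_of_nonneg (div_nonneg (hk0 _ (hmem t ht)).le ht0.le),
      div_mul_eq_mul_div]
    have := hNb (t * V (v / t)) _ (hmem t ht)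
    have := hkA _ (hmem t ht)
    gcongr
  have hY0 : Tendsto Y atTop (𝓝 0) := by
    refine squeeze_zero_norm' ((eventually_ge_atTop s).mono fun t ht => hYb t ht) ?_
    exact tendsto_const_nhds.div_atTop tendsto_id
  have hfin := integral_Ioi_of_hasDerivAt_of_tendsto' hYD (hRI.sub hI) hY0
  rw [integral_sub hRI hI, zero_sub] at hfin
  have heq : ∫ t in Ioi s, (F t / (t : ℂ) - avg (v / t) / (t : ℂ)) =
      (∫ t in Ioi s, R t) + Y s := by
    linear_combination -hfin
  have hA₁ : 0 ≤ A₁ := mul_nonneg hA (Real.rpow_nonneg ((div_pos hv hs).le.trans hvs.le) _)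
  have hRn : ‖∫ t in Ioi s, R t‖ ≤ (A * A + A₁ * (A + A)) / s := by
    refine (norm_integral_le_of_norm_le hbint
      ((ae_restrict_mem measurableSet_Ioi).mono hRb)).trans (le_of_eq ?_)
    rw [integral_const_mul, integral_Ioi_rpow_of_lt (by norm_num) hs]
    norm_num
    rw [Real.rpow_neg_one]
    rfl
  rw [heq]
  refine (norm_add_le _ _).trans ((add_le_add hRn (hYb s self_mem_Ici)).trans ?_)
  rw [← add_div]
  gcongr
  nlinarith [mul_nonneg hA hA, mul_nonneg hA₁ (add_nonneg hA hA)]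

/-! ### Theta functions as power series in the nome. -/

/-- The series `∑ (2πin)^k p^(2n² + jn) e^{2πiny}`. For `p = e^{iπτ/2}` it is the `k`-th derivative
of `θ₃(· | τ)` at `y + jτ/4`. -/
def thetaSeries (j : ℤ) (k : ℕ) (y p : ℝ) : ℂ :=
  ∑' n : ℤ, (2 * Real.pi * Complex.I * n) ^ k * (p : ℂ) ^ (2 * n ^ 2 + j * n).toNat *
    Complex.exp (2 * Real.pi * Complex.I * n * y)

/-- Everything follows from `|jn| ≤ |n| ≤ n²`. The lower bound gives geometric domination, the upper
one controls the factor produced by differentiating in `p`, and the last identity says that `toNat`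
does not truncate. -/
lemma toNat_exponent {j : ℤ} (hj : |j| ≤ 1) (n : ℤ) :
    n.natAbs ≤ (2 * n ^ 2 + j * n).toNat ∧ (2 * n ^ 2 + j * n).toNat ≤ 3 * n.natAbs ^ 2 ∧
      ((2 * n ^ 2 + j * n).toNat : ℤ) = 2 * n ^ 2 + j * n := by
  have h1 : |n| ≤ n ^ 2 := by rw [← sq_abs]; exact Int.le_self_sq |n|
  have h2 : |j * n| ≤ |n| := by
    rw [abs_mul]; exact mul_le_of_le_one_left (abs_nonneg n) hj
  have h3 := abs_le.1 h2
  have h4 : (n.natAbs : ℤ) = |n| := Int.natCast_natAbs n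
  have h5 : ((n.natAbs ^ 2 : ℕ) : ℤ) = n ^ 2 := by push_cast; exact sq_abs n
  have h0 := abs_nonneg n
  refine ⟨?_, ?_, ?_⟩ <;> omega

lemma norm_two_pi_I_mul (n : ℤ) :
    ‖(2 * Real.pi * Complex.I * n : ℂ)‖ = 2 * Real.pi * n.natAbs := by
  simp [abs_of_pos Real.pi_pos, Nat.cast_natAbs]

lemma summable_natAbs_pow_mul_geometric (k : ℕ) {ρ : ℝ} (h0 : 0 ≤ ρ) (h1 : ρ < 1) :
    Summable fun n : ℤ => (n.natAbs : ℝ) ^ k * ρ ^ n.natAbs := by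
  have h := summable_pow_mul_geometric_of_norm_lt_one (R := ℝ) k
    (r := ρ) (by rwa [Real.norm_of_nonneg h0])
  apply Summable.of_nat_of_neg <;> simpa using h

lemma thetaSeries_zero {j : ℤ} (hj : |j| ≤ 1) (k : ℕ) (y : ℝ) :
    thetaSeries j k y 0 = 0 ^ k := by
  rw [thetaSeries, tsum_eq_single 0]
  · simp
  · intro n hn
    have := (toNat_exponent hj n).1
    rw [Complex.ofReal_zero, zero_pow (by have := Int.natAbs_pos.2 hn; omega)]
    simp

lemma thetaSeries_add_one (j : ℤ) (k : ℕ) (y p : ℝ) :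
    thetaSeries j k (y + 1) p = thetaSeries j k y p := by
  refine tsum_congr fun n => ?_
  congr 1
  rw [show (2 * Real.pi * Complex.I * n * ((y + 1 : ℝ) : ℂ)) =
    2 * Real.pi * Complex.I * n * y + n * (2 * Real.pi * Complex.I) by push_cast; ring,
    Complex.exp_add, Complex.exp_int_mul_two_pi_mul_I, mul_one]

/-- Termwise differentiation with a geometric majorant. The range `|p| < 1` contains a full
neighbourhood of `p = 0`, the degenerate limit `τ → i∞`, where `C¹` regularity is needed. -/
lemma contDiffAt_thetaSeries {j : ℤ} (hj : |j| ≤ 1) (k : ℕ) (y : ℝ) {p : ℝ} (hp : |p| < 1) :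
    ContDiffAt ℝ 1 (fun q : ℝ × ℝ => thetaSeries j k q.1 q.2) (y, p) := by
  obtain ⟨ρ, hpρ, hρ1⟩ := exists_between hp
  have hρ0 : 0 < ρ := (abs_nonneg p).trans_lt hpρ
  set e : ℤ → ℕ := fun n => (2 * n ^ 2 + j * n).toNat with he
  set s : Set (ℝ × ℝ) := univ ×ˢ Ioo (-ρ) ρ with hs
  have hso : IsOpen s := isOpen_univ.prod isOpen_Ioo
  let ℓ₁ : ℝ × ℝ →L[ℝ] ℂ := Complex.ofRealCLM.comp (ContinuousLinearMap.fst ℝ ℝ ℝ)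
  let ℓ₂ : ℝ × ℝ →L[ℝ] ℂ := Complex.ofRealCLM.comp (ContinuousLinearMap.snd ℝ ℝ ℝ)
  have hℓ₁ : ‖ℓ₁‖ ≤ 1 := ContinuousLinearMap.opNorm_le_bound _ zero_le_one fun q => by
    simpa [ℓ₁] using norm_fst_le q
  have hℓ₂ : ‖ℓ₂‖ ≤ 1 := ContinuousLinearMap.opNorm_le_bound _ zero_le_one fun q => by
    simpa [ℓ₂] using norm_snd_le q
  let f : ℤ → ℝ × ℝ → ℂ := fun n q => (2 * Real.pi * Complex.I * n) ^ k * (q.2 : ℂ) ^ e n *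
    Complex.exp (2 * Real.pi * Complex.I * n * q.1)
  let f' : ℤ → ℝ × ℝ → ℝ × ℝ →L[ℝ] ℂ := fun n q =>
    ((2 * Real.pi * Complex.I * n) ^ k * (q.2 : ℂ) ^ e n * (2 * Real.pi * Complex.I * n) *
      Complex.exp (2 * Real.pi * Complex.I * n * q.1)) • ℓ₁ +
    ((2 * Real.pi * Complex.I * n) ^ k * (e n * (q.2 : ℂ) ^ (e n - 1)) *
      Complex.exp (2 * Real.pi * Complex.I * n * q.1)) • ℓ₂
  have hff' : ∀ n q, HasFDerivAt (f n) (f' n q) q := by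
    intro n q
    have h1 : HasFDerivAt (fun q : ℝ × ℝ => (q.1 : ℂ)) ℓ₁ q := ℓ₁.hasFDerivAt
    have h2 : HasFDerivAt (fun q : ℝ × ℝ => (q.2 : ℂ)) ℓ₂ q := ℓ₂.hasFDerivAt
    refine (((h2.pow (e n)).const_mul _).mul ((h1.const_mul _).cexp)).congr_fderiv ?_
    ext <;> simp [f', ℓ₁, ℓ₂] <;> ring
  -- `2π|n|` comes from the `y`-derivative, `3n²` from the exponent in the `p`-derivative, and `1/ρ`
  -- from the power of `p` lost in differentiating.
  set u : ℤ → ℝ := fun n => (2 * Real.pi) ^ k * (2 * Real.pi + 3) / ρ *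
    ((n.natAbs : ℝ) ^ (k + 2) * ρ ^ n.natAbs) with hu
  have hus : Summable u := (summable_natAbs_pow_mul_geometric (k + 2) hρ0.le hρ1).mul_left _
  have hbound : ∀ n q, q ∈ s → ‖f' n q‖ ≤ u n := by
    intro n q hq
    have hq2 : ‖(q.2 : ℂ)‖ ≤ ρ := by
      rw [Complex.norm_real]; exact (abs_lt.2 hq.2).le
    have hE : ‖Complex.exp (2 * Real.pi * Complex.I * n * q.1)‖ = 1 := by
      rw [show (2 * Real.pi * Complex.I * n * q.1 : ℂ) = ((2 * Real.pi * n * q.1 : ℝ) : ℂ) *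
        Complex.I by push_cast; ring, Complex.norm_exp_ofReal_mul_I]
    obtain ⟨hn1, hn2, -⟩ := toNat_exponent hj n
    rcases Nat.eq_zero_or_pos n.natAbs with h0 | h0
    · have hn : n = 0 := Int.natAbs_eq_zero.1 h0
      subst hn
      have : f' 0 q = 0 := by ext <;> simp [f', he]
      rw [this, norm_zero, hu]
      positivity
    have ha1 : (1 : ℝ) ≤ n.natAbs := by exact_mod_cast h0
    set a : ℝ := (n.natAbs : ℝ) with ha
    have hpow : ρ ^ (e n - 1) ≤ ρ ^ n.natAbs / ρ := by
      rw [le_div_iff₀ hρ0, ← pow_succ]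
      exact pow_le_pow_of_le_one hρ0.le hρ1.le (by simp only [he]; omega)
    have hpow' : ρ ^ e n ≤ ρ ^ n.natAbs / ρ :=
      (pow_le_pow_of_le_one hρ0.le hρ1.le (Nat.sub_le _ 1)).trans hpow
    have hen : (e n : ℝ) ≤ 3 * a ^ 2 := by rw [ha]; exact_mod_cast hn2
    have hG : 0 ≤ ρ ^ n.natAbs / ρ := by positivity
    have hb1 : ‖(q.2 : ℂ)‖ ^ e n ≤ ρ ^ n.natAbs / ρ :=
      (pow_le_pow_left₀ (norm_nonneg _) hq2 _).trans hpow'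
    have hb2 : ‖(q.2 : ℂ)‖ ^ (e n - 1) ≤ ρ ^ n.natAbs / ρ :=
      (pow_le_pow_left₀ (norm_nonneg _) hq2 _).trans hpow
    calc ‖f' n q‖ ≤ ((2 * Real.pi * a) ^ k * (ρ ^ n.natAbs / ρ) * (2 * Real.pi * a)) * 1 +
          ((2 * Real.pi * a) ^ k * (3 * a ^ 2 * (ρ ^ n.natAbs / ρ))) * 1 := by
          refine (norm_add_le _ _).trans (add_le_add ?_ ?_)
          · rw [norm_smul]
            refine mul_le_mul ?_ hℓ₁ (norm_nonneg _) (by positivity)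
            rw [norm_mul, norm_mul, norm_mul, norm_pow, norm_pow, norm_two_pi_I_mul, hE, mul_one]
            gcongr
          · rw [norm_smul]
            refine mul_le_mul ?_ hℓ₂ (norm_nonneg _) (by positivity)
            rw [norm_mul, norm_mul, norm_mul, norm_pow, norm_pow, norm_two_pi_I_mul, hE, mul_one,
              Complex.norm_natCast]
            gcongr
      _ = (2 * Real.pi) ^ k * (a ^ k * (2 * Real.pi * a + 3 * a ^ 2)) * (ρ ^ n.natAbs / ρ) := by
          rw [mul_pow]; ring
      _ ≤ (2 * Real.pi) ^ k * (a ^ k * ((2 * Real.pi + 3) * a ^ 2)) * (ρ ^ n.natAbs / ρ) := by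
          gcongr
          have : a ≤ a ^ 2 := by nlinarith
          nlinarith [Real.pi_pos]
      _ = u n := by rw [hu]; simp only; ring
  have hx₀ : ((0, 0) : ℝ × ℝ) ∈ s := ⟨mem_univ _, by simpa using hρ0⟩
  have hsum0 : Summable fun n => f n (0, 0) := by
    -- At `p = 0` only the constant term survives, so the base point needs no estimate.
    refine summable_of_ne_finset_zero (s := {0}) fun n hn => ?_
    have hn' : n ≠ 0 := by simpa using hn
    have := (toNat_exponent hj n).1
    have h0 : e n ≠ 0 := by have := Int.natAbs_pos.2 hn'; simp only [he]; omega
    simp [f, h0]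
  refine contDiffAt_one_iff.2 ⟨fun q => ∑' n, f' n q, s,
    hso.mem_nhds ⟨mem_univ _, abs_lt.1 hpρ⟩, ?_, fun q hq => ?_⟩
  · refine continuousOn_tsum (fun n => Continuous.continuousOn ?_) hus hbound
    fun_prop
  · exact hasFDerivAt_tsum_of_isPreconnected hus hso (isPreconnected_univ.prod isPreconnected_Ioo)
      (fun n q _ => hff' n q) hbound hx₀ hsum0 hq

/-- The `k`-th derivative in `z` of the Jacobi theta series. -/
def thetaDeriv (k : ℕ) (z τ : ℂ) : ℂ :=
  ∑' n : ℤ, (2 * Real.pi * Complex.I * n) ^ k * jacobiTheta₂_term n z τ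

lemma thetaDeriv_zero (z τ : ℂ) : thetaDeriv 0 z τ = theta3 z τ := by
  simp [thetaDeriv, theta3, jacobiTheta₂]

lemma hasDerivAt_thetaDeriv (k : ℕ) (z : ℂ) {τ : ℂ} (hτ : 0 < τ.im) :
    HasDerivAt (fun w => thetaDeriv k w τ) (thetaDeriv (k + 1) z τ) z := by
  have hbd : ∀ l : ℕ, ∀ n : ℤ, ∀ w ∈ Metric.ball (0 : ℂ) (‖z‖ + 1),
      ‖(2 * Real.pi * Complex.I * n : ℂ) ^ l * jacobiTheta₂_term n w τ‖ ≤
        (2 * Real.pi) ^ l * ((|n| ^ l : ℝ) *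
          Real.exp (-Real.pi * (τ.im * n ^ 2 - 2 * (‖z‖ + 1) * |n|))) := by
    intro l n w hw
    have hw' : |w.im| ≤ ‖z‖ + 1 := (Complex.abs_im_le_norm w).trans (mem_ball_zero_iff.1 hw).le
    rw [norm_mul, norm_pow, norm_two_pi_I_mul, mul_pow, mul_assoc]
    have := norm_jacobiTheta₂_term_le hτ hw' le_rfl n
    rw [Nat.cast_natAbs]
    push_cast at this ⊢
    gcongr
  have hsum : ∀ l : ℕ, Summable fun n : ℤ => (2 * Real.pi) ^ l * ((|n| ^ l : ℝ) *
      Real.exp (-Real.pi * (τ.im * n ^ 2 - 2 * (‖z‖ + 1) * |n|))) := fun l =>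
    (summable_pow_mul_jacobiTheta₂_term_bound _ hτ l).mul_left _
  have hz : z ∈ Metric.ball (0 : ℂ) (‖z‖ + 1) := by simp
  refine hasDerivAt_tsum_of_isPreconnected (hsum (k + 1)) Metric.isOpen_ball
    (convex_ball _ _).isPreconnected (fun n w _ => ?_) (hbd (k + 1)) hz
    ((hsum k).of_norm_bounded fun n => hbd k n z hz) hz
  have h1 : HasDerivAt (fun w : ℂ => 2 * Real.pi * Complex.I * n * w +
      Real.pi * Complex.I * n ^ 2 * τ) (2 * Real.pi * Complex.I * n) w := by
    simpa using ((hasDerivAt_id w).const_mul (2 * Real.pi * Complex.I * n : ℂ)).add_const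
      (Real.pi * Complex.I * n ^ 2 * τ)
  refine (h1.cexp.const_mul _).congr_deriv ?_
  rw [jacobiTheta₂_term, pow_succ]
  ring

lemma deriv_theta0 {τ : ℂ} (hτ : 0 < τ.im) :
    deriv (fun w => theta0 w τ) = fun w => thetaDeriv 1 (w + 1 / 2) τ := by
  funext w
  have h := (hasDerivAt_thetaDeriv 0 (w + 1 / 2) hτ).comp_add_const w (1 / 2)
  simp only [thetaDeriv_zero] at h
  exact h.deriv

lemma hasDerivAt_deriv_theta0 {τ : ℂ} (hτ : 0 < τ.im) (w : ℂ) :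
    HasDerivAt (deriv fun w => theta0 w τ) (thetaDeriv 2 (w + 1 / 2) τ) w := by
  rw [deriv_theta0 hτ]
  exact (hasDerivAt_thetaDeriv 1 (w + 1 / 2) hτ).comp_add_const w (1 / 2)

lemma logTheta0_eq {τ : ℂ} (hτ : 0 < τ.im) (w : ℂ) :
    logTheta0 w τ = thetaDeriv 1 (w + 1 / 2) τ / thetaDeriv 0 (w + 1 / 2) τ := by
  rw [logTheta0, deriv_theta0 hτ, thetaDeriv_zero, theta0]

lemma secTheta0_eq {τ : ℂ} (hτ : 0 < τ.im) (w : ℂ) :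
    secTheta0 w τ = thetaDeriv 2 (w + 1 / 2) τ / thetaDeriv 0 (w + 1 / 2) τ := by
  rw [secTheta0, iteratedDeriv_succ, iteratedDeriv_one, (hasDerivAt_deriv_theta0 hτ w).deriv,
    thetaDeriv_zero, theta0]

lemma deriv_logTheta0_eq {τ : ℂ} (hτ : 0 < τ.im) (w : ℂ) (hw : thetaDeriv 0 (w + 1 / 2) τ ≠ 0) :
    deriv (fun w => logTheta0 w τ) w =
      thetaDeriv 2 (w + 1 / 2) τ / thetaDeriv 0 (w + 1 / 2) τ -
        (thetaDeriv 1 (w + 1 / 2) τ / thetaDeriv 0 (w + 1 / 2) τ) ^ 2 := by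
  have h0 : HasDerivAt (fun w => thetaDeriv 0 (w + 1 / 2) τ) (thetaDeriv 1 (w + 1 / 2) τ) w :=
    (hasDerivAt_thetaDeriv 0 (w + 1 / 2) hτ).comp_add_const w (1 / 2)
  have h1 : HasDerivAt (fun w => thetaDeriv 1 (w + 1 / 2) τ) (thetaDeriv 2 (w + 1 / 2) τ) w :=
    (hasDerivAt_thetaDeriv 1 (w + 1 / 2) hτ).comp_add_const w (1 / 2)
  rw [funext fun w => logTheta0_eq hτ w, (h1.fun_div h0 hw).deriv]
  field_simp

lemma iteratedDeriv_two_theta3 {τ : ℂ} (hτ : 0 < τ.im) (z : ℂ) :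
    iteratedDeriv 2 (fun y => theta3 y τ) z = thetaDeriv 2 z τ := by
  have h0 : deriv (fun y => theta3 y τ) = fun y => thetaDeriv 1 y τ := by
    funext y
    have h := hasDerivAt_thetaDeriv 0 y hτ
    simp only [thetaDeriv_zero] at h
    exact h.deriv
  rw [iteratedDeriv_succ, iteratedDeriv_one, h0, (hasDerivAt_thetaDeriv 1 z hτ).deriv]

/-- Since `iπτn² + 2πin·jτ/4 = (iπτ/2)(2n² + jn)`, the quarter-period shift by `d` becomes an
integral power of `p`. -/
lemma thetaDeriv_eq_thetaSeries {j : ℤ} (hj : |j| ≤ 1) (k : ℕ) (y : ℝ) {p : ℝ} {τ : ℂ}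
    (hp : (p : ℂ) = Complex.exp (Real.pi * Complex.I * τ / 2)) :
    thetaDeriv k (y + j * τ / 4) τ = thetaSeries j k y p := by
  refine tsum_congr fun n => ?_
  rw [jacobiTheta₂_term, mul_assoc (_ ^ k), hp, ← Complex.exp_nat_mul, ← Complex.exp_add]
  congr 2
  have h : (((2 * n ^ 2 + j * n).toNat : ℤ) : ℂ) = ((2 * n ^ 2 + j * n : ℤ) : ℂ) := by
    rw [(toNat_exponent hj n).2.2]
  rw [Int.cast_natCast] at h
  rw [h]
  push_cast
  ring

/-! ### Zeros -/

/-- For purely imaginary `z` and `τ` every term of the series is a positive real number. -/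
lemma jacobiTheta₂_ne_zero_of_imaginary (w : ℝ) {t : ℝ} (ht : 0 < t) :
    jacobiTheta₂ (Complex.I * w) (Complex.I * t) ≠ 0 := by
  have him : 0 < (Complex.I * t : ℂ).im := by simpa using ht
  have hterm : ∀ n : ℤ, jacobiTheta₂_term n (Complex.I * w) (Complex.I * t) =
      ((Real.exp (-(2 * Real.pi * n * w) - Real.pi * n ^ 2 * t) : ℝ) : ℂ) := by
    intro n
    rw [jacobiTheta₂_term, Complex.ofReal_exp]
    congr 1
    push_cast
    linear_combination (2 * Real.pi * n * w + Real.pi * n ^ 2 * t : ℂ) * Complex.I_sq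
  have hs := (hasSum_jacobiTheta₂_term (Complex.I * w) him).summable
  simp only [hterm] at hs
  have hs' := Complex.summable_ofReal.1 hs
  rw [jacobiTheta₂, tsum_congr hterm, ← Complex.ofReal_tsum]
  exact_mod_cast (hs'.tsum_pos (fun n => (Real.exp_pos _).le) 0 (Real.exp_pos _)).ne'

/-- The modular inversion `τ ↦ -1/τ` carries a real argument to an imaginary one. -/
lemma jacobiTheta₂_ne_zero_of_real (y : ℝ) {t : ℝ} (ht : 0 < t) :
    jacobiTheta₂ y (Complex.I * t) ≠ 0 := by
  have htc : (t : ℂ) ≠ 0 := by exact_mod_cast ht.ne'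
  rw [jacobiTheta₂_functional_equation]
  have h1 : (y : ℂ) / (Complex.I * t) = Complex.I * ((-(y / t) : ℝ) : ℂ) := by
    push_cast
    field_simp
    rw [Complex.I_sq]
    ring
  have h2 : -1 / (Complex.I * t : ℂ) = Complex.I * ((1 / t : ℝ) : ℂ) := by
    push_cast
    field_simp
    rw [Complex.I_sq]
  have h3 : -Complex.I * (Complex.I * t) = t := by
    rw [← mul_assoc, neg_mul, Complex.I_mul_I, neg_neg, one_mul]
  rw [h1, h2, h3]
  refine mul_ne_zero (mul_ne_zero (one_div_ne_zero ?_) (Complex.exp_ne_zero _))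
    (jacobiTheta₂_ne_zero_of_imaginary _ (by positivity))
  rw [Complex.cpow_ne_zero_iff]
  exact Or.inl htc

/-- A duplication formula: the product of two theta functions at arguments `y ± τ/4`. -/
lemma jacobiTheta₂_mul_quarter (y : ℂ) {τ : ℂ} (hτ : 0 < τ.im) :
    jacobiTheta₂ (y - τ / 4) τ * jacobiTheta₂ (y + τ / 4) τ =
      jacobiTheta₂ (τ / 2) (2 * τ) * jacobiTheta₂ y (τ / 2) := by
  have hs : ∀ z, Summable fun n => ‖jacobiTheta₂_term n z τ‖ := fun z =>
    (hasSum_jacobiTheta₂_term z hτ).summable.norm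
  -- Sum over `r`, the sum of the two indices, and over the first index `m`. With `l = r - 2m` one
  -- has `m² + (r - m)² = (r² + l²)/2`, which separates the quadratic form.
  let E : ℤ × ℤ ≃ ℤ × ℤ :=
    { toFun := fun q => (q.2, q.1 - q.2)
      invFun := fun q => (q.1 + q.2, q.1)
      left_inv := fun q => by ext <;> simp
      right_inv := fun q => by ext <;> simp }
  let G : ℤ → ℤ → ℂ := fun r m =>
    Complex.exp (Real.pi * Complex.I * τ / 2 * ((r - 2 * m) * (r - 2 * m + 1)))
  -- The inner sum runs over `l` of the parity of `r`; both parities give the same value because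
  -- `l(l + 1)` is invariant under `l ↦ -1 - l`.
  have hG : ∀ r, ∑' m, G r m = jacobiTheta₂ (τ / 2) (2 * τ) := by
    intro r
    rcases Int.even_or_odd' r with ⟨i, rfl | rfl⟩
    · rw [← (Equiv.subLeft i).tsum_eq, jacobiTheta₂]
      refine tsum_congr fun m => ?_
      simp only [G, jacobiTheta₂_term, Equiv.subLeft_apply]
      congr 1
      push_cast
      ring
    · rw [← (Equiv.addRight (i + 1)).tsum_eq, jacobiTheta₂]
      refine tsum_congr fun m => ?_
      simp only [G, jacobiTheta₂_term, Equiv.coe_addRight]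
      congr 1
      push_cast
      ring
  have hsum := summable_mul_of_summable_norm (hs (y - τ / 4)) (hs (y + τ / 4))
  have hterm : ∀ q : ℤ × ℤ, jacobiTheta₂_term (E q).1 (y - τ / 4) τ *
      jacobiTheta₂_term (E q).2 (y + τ / 4) τ = jacobiTheta₂_term q.1 y (τ / 2) * G q.1 q.2 := by
    rintro ⟨r, m⟩
    simp only [G, jacobiTheta₂_term, E, Equiv.coe_fn_mk, ← Complex.exp_add]
    congr 1
    push_cast
    ring
  rw [jacobiTheta₂, jacobiTheta₂, tsum_mul_tsum_of_summable_norm (hs _) (hs _), ← E.tsum_eq]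
  rw [← E.summable_iff] at hsum
  simp only [Function.comp_def, hterm] at hsum ⊢
  rw [hsum.tsum_prod]
  simp only [tsum_mul_left, hG, tsum_mul_right]
  rw [← jacobiTheta₂, mul_comm]

/-- For `j = ±1` the value is a factor of the product in `jacobiTheta₂_mul_quarter`, whose right
side has only imaginary and real arguments. -/
lemma thetaSeries_ne_zero {j : ℤ} (hj : |j| ≤ 1) (y : ℝ) {p : ℝ} (hp0 : 0 ≤ p) (hp1 : p < 1) :
    thetaSeries j 0 y p ≠ 0 := by
  rcases hp0.eq_or_lt with rfl | hp0
  · simp [thetaSeries_zero hj]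
  -- Chosen so that `τ = it` has `e^{iπτ/2} = p`.
  set t : ℝ := -2 * Real.log p / Real.pi with ht
  have ht0 : 0 < t := div_pos (by linarith [Real.log_neg hp0 hp1]) Real.pi_pos
  have him : 0 < (Complex.I * t : ℂ).im := by simpa using ht0
  have hp : (p : ℂ) = Complex.exp (Real.pi * Complex.I * (Complex.I * t) / 2) := by
    have h1 : Real.pi * Complex.I * (Complex.I * t) / 2 = ((Real.log p : ℝ) : ℂ) := by
      have hpi : (Real.pi : ℂ) ≠ 0 := by exact_mod_cast Real.pi_ne_zero
      rw [ht]
      push_cast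
      field_simp
      rw [Complex.I_sq]
      ring
    rw [h1, ← Complex.ofReal_exp, Real.exp_log hp0]
  have hprod : jacobiTheta₂ ((y : ℂ) - Complex.I * t / 4) (Complex.I * t) *
      jacobiTheta₂ (y + Complex.I * t / 4) (Complex.I * t) ≠ 0 := by
    rw [jacobiTheta₂_mul_quarter _ him]
    refine mul_ne_zero ?_ ?_
    · rw [show Complex.I * t / 2 = Complex.I * ((t / 2 : ℝ) : ℂ) by push_cast; ring,
        show 2 * (Complex.I * t) = Complex.I * ((2 * t : ℝ) : ℂ) by push_cast; ring]
      exact jacobiTheta₂_ne_zero_of_imaginary _ (by positivity)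
    · rw [show Complex.I * t / 2 = Complex.I * ((t / 2 : ℝ) : ℂ) by push_cast; ring]
      exact jacobiTheta₂_ne_zero_of_real y (by positivity)
  rw [← thetaDeriv_eq_thetaSeries hj 0 y hp, thetaDeriv_zero, theta3]
  have h3 := abs_le.1 hj
  have hcases : j = -1 ∨ j = 0 ∨ j = 1 := by omega
  rcases hcases with rfl | rfl | rfl
  · convert left_ne_zero_of_mul hprod using 2
    push_cast
    ring
  · convert jacobiTheta₂_ne_zero_of_real y ht0 using 2
    simp
  · convert right_ne_zero_of_mul hprod using 2
    push_cast
    ring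

/-! ### Elliptic integrals as functions of the parameter `m = k²` -/

lemma one_sub_mul_sin_sq_pos {m : ℝ} (hm : m < 1) (t : ℝ) : 0 < 1 - m * Real.sin t ^ 2 := by
  have h1 := Real.sin_sq_le_one t
  have h2 := sq_nonneg (Real.sin t)
  rcases le_or_gt m 0 with h | h <;> nlinarith

/-- The integral `∫₀^{π/2} w(t) (1 - m sin² t)^r dt`. -/
def ellipticJ (w : ℝ → ℝ) (r m : ℝ) : ℝ :=
  ∫ t in (0 : ℝ)..(Real.pi / 2), w t * (1 - m * Real.sin t ^ 2) ^ r

lemma continuous_ellipticJ_integrand {w : ℝ → ℝ} (hw : Continuous w) (r : ℝ) {m : ℝ} (hm : m < 1) :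
    Continuous fun t => w t * (1 - m * Real.sin t ^ 2) ^ r :=
  hw.mul (Continuous.rpow_const (by fun_prop) fun t => Or.inl (one_sub_mul_sin_sq_pos hm t).ne')

lemma hasDerivAt_ellipticJ {w : ℝ → ℝ} (hw : Continuous w) (r : ℝ) {m : ℝ} (hm : m < 1) :
    HasDerivAt (ellipticJ w r) (ellipticJ (fun t => -r * Real.sin t ^ 2 * w t) (r - 1) m) m := by
  have hw' : Continuous fun t => -r * Real.sin t ^ 2 * w t := by fun_prop
  obtain ⟨M, hmM, hM1⟩ := exists_between hm
  have hcomp : IsCompact (Icc (m - 1) M ×ˢ Icc (0 : ℝ) (Real.pi / 2)) := isCompact_Icc.prod isCompact_Icc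
  obtain ⟨C, hC⟩ := hcomp.exists_bound_of_continuousOn
    (f := fun q : ℝ × ℝ => -r * Real.sin q.2 ^ 2 * w q.2 * (1 - q.1 * Real.sin q.2 ^ 2) ^ (r - 1))
    (by
      refine ContinuousOn.mul (by fun_prop) (ContinuousOn.rpow_const (by fun_prop) fun q hq => ?_)
      exact Or.inl (one_sub_mul_sin_sq_pos (hq.1.2.trans_lt hM1) q.2).ne')
  refine (intervalIntegral.hasDerivAt_integral_of_dominated_loc_of_deriv_le (s := Icc (m - 1) M)
    (F' := fun m t => -r * Real.sin t ^ 2 * w t * (1 - m * Real.sin t ^ 2) ^ (r - 1))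
    (bound := fun _ => C) (Icc_mem_nhds (by linarith) hmM) ?_ ?_ ?_ ?_ ?_ ?_).2
  · filter_upwards [eventually_lt_nhds hm] with m' hm'
    exact (continuous_ellipticJ_integrand hw r hm').aestronglyMeasurable
  · exact (continuous_ellipticJ_integrand hw r hm).intervalIntegrable _ _
  · exact (continuous_ellipticJ_integrand hw' (r - 1) hm).aestronglyMeasurable
  · refine Eventually.of_forall fun t ht m' hm' => hC (m', t) ⟨hm', ?_⟩
    rw [uIoc_of_le (by positivity)] at ht
    exact Ioc_subset_Icc_self ht
  · exact continuous_const.intervalIntegrable _ _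
  · refine Eventually.of_forall fun t _ m' hm' => ?_
    have h1 : HasDerivAt (fun m => 1 - m * Real.sin t ^ 2) (-(Real.sin t ^ 2)) m' := by
      simpa using ((hasDerivAt_id m').mul_const (Real.sin t ^ 2)).const_sub 1
    refine ((h1.rpow_const (p := r)
      (Or.inl (one_sub_mul_sin_sq_pos (hm'.2.trans_lt hM1) t).ne')).const_mul (w t)).congr_deriv ?_
    ring

lemma ellipticJ_pos {w : ℝ → ℝ} (hw : Continuous w) (hpos : ∀ t ∈ Ioo 0 (Real.pi / 2), 0 < w t)
    (r : ℝ) {m : ℝ} (hm : m < 1) : 0 < ellipticJ w r m := by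
  refine intervalIntegral.intervalIntegral_pos_of_pos_on
    ((continuous_ellipticJ_integrand hw r hm).intervalIntegrable _ _) (fun t ht => ?_) (by positivity)
  exact mul_pos (hpos t ht) (Real.rpow_pos_of_pos (one_sub_mul_sin_sq_pos hm t) r)

/-- The complete elliptic integral `K`, in terms of the parameter. -/
def paramK (m : ℝ) : ℝ := ellipticJ (fun _ => 1) (-1 / 2) m

/-- The complete elliptic integral `E`, in terms of the parameter. -/
def paramE (m : ℝ) : ℝ := ellipticJ (fun _ => 1) (1 / 2) m

/-- The integral `∫₀^{π/2} cos² t / √(1 - m sin² t) dt`. -/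
def paramB (m : ℝ) : ℝ := ellipticJ (fun t => Real.cos t ^ 2) (-1 / 2) m

lemma paramK_pos {m : ℝ} (hm : m < 1) : 0 < paramK m :=
  ellipticJ_pos continuous_const (fun _ _ => one_pos) _ hm

lemma paramB_pos {m : ℝ} (hm : m < 1) : 0 < paramB m := by
  refine ellipticJ_pos (by fun_prop) (fun t ht => ?_) _ hm
  have := Real.cos_pos_of_mem_Ioo ⟨by linarith [ht.1, Real.pi_pos], ht.2⟩
  positivity

lemma ellipticK_eq_paramK {k m : ℝ} (h : k ^ 2 = m) (hm : m < 1) : ellipticK k = paramK m := by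
  refine intervalIntegral.integral_congr fun t _ => ?_
  simp only [h, one_mul]
  rw [Real.sqrt_eq_rpow, one_div, ← Real.rpow_neg (one_sub_mul_sin_sq_pos hm t).le]
  norm_num

lemma ellipticE_eq_paramE {k m : ℝ} (h : k ^ 2 = m) : ellipticE k = paramE m := by
  refine intervalIntegral.integral_congr fun t _ => ?_
  simp only [h, one_mul]
  rw [Real.sqrt_eq_rpow]

/-- Pointwise, `1 - m sin² t = (1 - m) + m cos² t`. Hence `E - (1 - m) K = m B`, the combination
behind both `κ` and `V`; `B` stays regular and positive at `m = 0`. -/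
lemma paramE_eq {m : ℝ} (hm : m < 1) : paramE m = (1 - m) * paramK m + m * paramB m := by
  have h1 := (continuous_ellipticJ_integrand (continuous_const (y := (1 : ℝ))) (-1 / 2) hm)
  have h2 := (continuous_ellipticJ_integrand (by fun_prop : Continuous fun t => Real.cos t ^ 2)
    (-1 / 2) hm)
  rw [paramE, paramK, paramB, ellipticJ, ellipticJ, ellipticJ,
    ← intervalIntegral.integral_const_mul, ← intervalIntegral.integral_const_mul,
    ← intervalIntegral.integral_add ((h1.const_mul _).intervalIntegrable _ _)
      ((h2.const_mul _).intervalIntegrable _ _)]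
  refine intervalIntegral.integral_congr fun t _ => ?_
  have hp := one_sub_mul_sin_sq_pos hm t
  rw [show (1 / 2 : ℝ) = 1 + -1 / 2 by norm_num, Real.rpow_add hp, Real.rpow_one, Real.cos_sq']
  ring

lemma hasDerivAt_paramE {m : ℝ} (hm : m < 1) :
    HasDerivAt paramE (-(paramK m - paramB m) / 2) m := by
  refine (hasDerivAt_ellipticJ continuous_const (1 / 2) hm).congr_deriv ?_
  have h1 := (continuous_ellipticJ_integrand (continuous_const (y := (1 : ℝ))) (-1 / 2) hm)
  have h2 := (continuous_ellipticJ_integrand (by fun_prop : Continuous fun t => Real.cos t ^ 2)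
    (-1 / 2) hm)
  rw [show -(paramK m - paramB m) / 2 = (-1 / 2) * (paramK m - paramB m) by ring,
    paramK, paramB, ellipticJ, ellipticJ, ellipticJ,
    ← intervalIntegral.integral_sub (h1.intervalIntegrable _ _) (h2.intervalIntegrable _ _),
    ← intervalIntegral.integral_const_mul]
  refine intervalIntegral.integral_congr fun t _ => ?_
  rw [Real.cos_sq', show (1 / 2 - 1 : ℝ) = -1 / 2 by norm_num]
  ring

/-- `dK/dm = B / (2 (1 - m))`. -/
lemma hasDerivAt_paramK {m : ℝ} (hm : m < 1) :
    HasDerivAt paramK (paramB m / (2 * (1 - m))) m := by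
  refine (hasDerivAt_ellipticJ continuous_const (-1 / 2) hm).congr_deriv ?_
  have hm' : 1 - m ≠ 0 := by linarith
  have h1 := (continuous_ellipticJ_integrand
    (by fun_prop : Continuous fun t => -(-1 / 2 : ℝ) * Real.sin t ^ 2 * 1) (-1 / 2 - 1) hm)
  have h2 := (continuous_ellipticJ_integrand (by fun_prop : Continuous fun t => Real.cos t ^ 2)
    (-1 / 2) hm)
  -- An exact derivative whose primitive vanishes at both endpoints; integrating it gives `B = 2(1 -
  -- m) dK/dm`.
  have hd : ∀ t ∈ uIcc 0 (Real.pi / 2),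
      HasDerivAt (fun t => Real.sin t * Real.cos t * (1 - m * Real.sin t ^ 2) ^ (-1 / 2 : ℝ))
        (Real.cos t ^ 2 * (1 - m * Real.sin t ^ 2) ^ (-1 / 2 : ℝ) - 2 * (1 - m) *
          (-(-1 / 2 : ℝ) * Real.sin t ^ 2 * 1 * (1 - m * Real.sin t ^ 2) ^ (-1 / 2 - 1 : ℝ))) t := by
    intro t _
    have hp := one_sub_mul_sin_sq_pos hm t
    have h3 : HasDerivAt (fun t => 1 - m * Real.sin t ^ 2)
        (-(m * (2 * Real.sin t * Real.cos t))) t := by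
      simpa using (((Real.hasDerivAt_sin t).pow 2).const_mul m).const_sub 1
    refine (((Real.hasDerivAt_sin t).mul (Real.hasDerivAt_cos t)).mul
      (h3.rpow_const (p := -1 / 2) (Or.inl hp.ne'))).congr_deriv ?_
    have h4 : (1 - m * Real.sin t ^ 2) ^ (-1 / 2 : ℝ) =
        (1 - m * Real.sin t ^ 2) * (1 - m * Real.sin t ^ 2) ^ (-1 / 2 - 1 : ℝ) := by
      rw [show (-1 / 2 : ℝ) = 1 + (-1 / 2 - 1) by norm_num, Real.rpow_add hp, Real.rpow_one]
      norm_num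
    simp only [Pi.mul_apply]
    rw [h4]
    have h5 := Real.sin_sq_add_cos_sq t
    have h6 : Real.cos t ^ 2 = 1 - Real.sin t ^ 2 := by linarith
    ring_nf
    rw [h6]
    ring
  have h3 := intervalIntegral.integral_eq_sub_of_hasDerivAt hd
    ((h2.sub (h1.const_mul _)).intervalIntegrable _ _)
  rw [intervalIntegral.integral_sub (h2.intervalIntegrable _ _)
    ((h1.const_mul _).intervalIntegrable _ _), intervalIntegral.integral_const_mul] at h3
  simp only [Real.sin_zero, Real.cos_pi_div_two, mul_zero, zero_mul, sub_zero] at h3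
  rw [paramB, ellipticJ, ellipticJ]
  rw [eq_div_iff (mul_ne_zero two_ne_zero hm')]
  linarith

/-- The derivative of `m B(m) = E - (1 - m) K`. -/
lemma hasDerivAt_mul_paramB {m : ℝ} (hm : m < 1) :
    HasDerivAt (fun m => m * paramB m) (paramK m / 2) m := by
  have hm' : 1 - m ≠ 0 := by linarith
  have h1 : HasDerivAt (fun m : ℝ => 1 - m) (-1) m := by
    simpa using (hasDerivAt_id m).const_sub 1
  have h2 := (hasDerivAt_paramE hm).sub (h1.mul (hasDerivAt_paramK hm))
  refine (h2.congr_deriv ?_).congr_of_eventuallyEq ?_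
  · field_simp
    ring
  · filter_upwards [eventually_lt_nhds hm] with m' hm'
    simp only [Pi.sub_apply, Pi.mul_apply]
    rw [paramE_eq hm']
    ring

/-! ### Legendre's relation -/

/-- The integrand `√(cos² t + m sin² t)` lies between `cos t` and `cos t + √m`. This gives the limit
at `m → 0` that fixes the constant in Legendre's relation. -/
lemma paramE_one_sub_bounds {m : ℝ} (h0 : 0 < m) :
    1 ≤ paramE (1 - m) ∧ paramE (1 - m) ≤ 1 + √m * (Real.pi / 2) := by
  have hc := (continuous_ellipticJ_integrand (continuous_const (y := (1 : ℝ))) (1 / 2)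
    (by linarith : 1 - m < 1))
  have hcos : ∫ t in (0 : ℝ)..(Real.pi / 2), Real.cos t = 1 := by simp
  have hsq : ∀ t, 1 - (1 - m) * Real.sin t ^ 2 = Real.cos t ^ 2 + m * Real.sin t ^ 2 := fun t => by
    rw [Real.cos_sq']; ring
  have hcn : ∀ t ∈ Icc 0 (Real.pi / 2), 0 ≤ Real.cos t := fun t ht =>
    Real.cos_nonneg_of_mem_Icc ⟨by linarith [ht.1, Real.pi_pos], ht.2⟩
  constructor
  · refine hcos.ge.trans ?_
    refine intervalIntegral.integral_mono_on (by positivity)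
      (Real.continuous_cos.intervalIntegrable _ _) (hc.intervalIntegrable _ _) fun t ht => ?_
    rw [one_mul, ← Real.sqrt_eq_rpow, hsq]
    refine Real.le_sqrt_of_sq_le ?_
    have : 0 ≤ m * Real.sin t ^ 2 := by positivity
    linarith
  · have h2 : ∫ t in (0 : ℝ)..(Real.pi / 2), (Real.cos t + √m) = 1 + √m * (Real.pi / 2) := by
      rw [intervalIntegral.integral_add (Real.continuous_cos.intervalIntegrable _ _)
        (continuous_const.intervalIntegrable _ _), hcos]
      simp [mul_comm]
    rw [← h2]
    refine intervalIntegral.integral_mono_on (by positivity) (hc.intervalIntegrable _ _)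
      ((Real.continuous_cos.add continuous_const).intervalIntegrable _ _) fun t ht => ?_
    rw [one_mul, ← Real.sqrt_eq_rpow, hsq]
    refine Real.sqrt_le_iff.2 ⟨add_nonneg (hcn t ht) (Real.sqrt_nonneg _), ?_⟩
    have h3 := Real.sq_sqrt h0.le
    have h4 := mul_nonneg (hcn t ht) (Real.sqrt_nonneg m)
    have h5 := Real.sin_sq_le_one t
    nlinarith

/-- The integrand of `K` at parameter `1 - m` is at most `1/√m`, enough to make `m K(1 - m)` tend to
`0`. -/
lemma mul_paramK_one_sub_le {m : ℝ} (h0 : 0 < m) (h1 : m < 1) :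
    m * paramK (1 - m) ≤ √m * (Real.pi / 2) := by
  have hc := (continuous_ellipticJ_integrand (continuous_const (y := (1 : ℝ))) (-1 / 2)
    (by linarith : 1 - m < 1))
  have h2 : ∫ t in (0 : ℝ)..(Real.pi / 2), (√m / m) = √m / m * (Real.pi / 2) := by
    rw [intervalIntegral.integral_const, smul_eq_mul]
    ring
  have h3 : paramK (1 - m) ≤ √m / m * (Real.pi / 2) := by
    rw [← h2]
    refine intervalIntegral.integral_mono_on (by positivity) (hc.intervalIntegrable _ _)
      (continuous_const.intervalIntegrable _ _) fun t ht => ?_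
    have hp := one_sub_mul_sin_sq_pos (by linarith : 1 - m < 1) t
    rw [one_mul, Real.sqrt_div_self', neg_div, Real.rpow_neg hp.le, ← Real.sqrt_eq_rpow, ← one_div]
    refine one_div_le_one_div_of_le (Real.sqrt_pos.2 h0) (Real.sqrt_le_sqrt ?_)
    have h5 := Real.sin_sq_add_cos_sq t
    have h6 := Real.sin_sq_le_one t
    nlinarith [sq_nonneg (Real.sin t), sq_nonneg (Real.cos t)]
  calc m * paramK (1 - m) ≤ m * (√m / m * (Real.pi / 2)) := by gcongr
    _ = _ := by field_simp

/-- Legendre's relation. -/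
theorem legendre_relation {m : ℝ} (hm : m ∈ Ioo (0 : ℝ) 1) :
    m * paramB m * paramK (1 - m) + (1 - m) * paramB (1 - m) * paramK m = Real.pi / 2 := by
  set f : ℝ → ℝ := fun m => m * paramB m * paramK (1 - m) + (1 - m) * paramB (1 - m) * paramK m
  have hsub : ∀ x : ℝ, HasDerivAt (fun m : ℝ => 1 - m) (-1) x := fun x => by
    simpa using (hasDerivAt_id x).const_sub 1
  -- The contributions `K(x) K(1 - x)/2` and `B(x) B(1 - x)/2` each occur with both signs.
  have hd : ∀ x ∈ Ioo (0 : ℝ) 1, HasDerivAt f 0 x := by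
    intro x hx
    have hx1 : 1 - x < 1 := by linarith [hx.1]
    have h1 := (hasDerivAt_mul_paramB hx.2).mul ((hasDerivAt_paramK hx1).comp x (hsub x))
    have h2 := ((hasDerivAt_mul_paramB hx1).comp x (hsub x)).mul (hasDerivAt_paramK hx.2)
    refine (h1.add h2).congr_deriv ?_
    have := hx.1.ne'
    have h3 : 1 - x ≠ 0 := by linarith [hx.2]
    simp only [Function.comp, sub_sub_cancel]
    field_simp
    ring
  have hconst : ∀ x ∈ Ioo (0 : ℝ) 1, f x = f m := fun x hx =>
    isOpen_Ioo.is_const_of_deriv_eq_zero isPreconnected_Ioo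
      (fun y hy => (hd y hy).differentiableAt.differentiableWithinAt)
      (fun y hy => (hd y hy).deriv) hx hm
  have hev : ∀ᶠ x in 𝓝[>] (0 : ℝ), x ∈ Ioo (0 : ℝ) 1 := Ioo_mem_nhdsGT one_pos
  have hlim1 : Tendsto f (𝓝[>] 0) (𝓝 (f m)) :=
    tendsto_const_nhds.congr' (hev.mono fun x hx => (hconst x hx).symm)
  have hK0 : paramK 0 = Real.pi / 2 := by simp [paramK, ellipticJ]
  have hsqrt : Tendsto (fun x : ℝ => √x * (Real.pi / 2)) (𝓝[>] 0) (𝓝 0) := by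
    have : Continuous fun x : ℝ => √x * (Real.pi / 2) := by fun_prop
    simpa using this.continuousAt.tendsto.mono_left (nhdsWithin_le_nhds (a := (0 : ℝ)))
  have hmK : Tendsto (fun x : ℝ => x * paramK (1 - x)) (𝓝[>] 0) (𝓝 0) := by
    refine tendsto_of_tendsto_of_tendsto_of_le_of_le' tendsto_const_nhds hsqrt ?_ ?_
    · filter_upwards [hev] with x hx
      exact mul_nonneg hx.1.le (paramK_pos (by linarith [hx.1])).le
    · filter_upwards [hev] with x hx using mul_paramK_one_sub_le hx.1 hx.2
  have hE : Tendsto (fun x : ℝ => paramE (1 - x)) (𝓝[>] 0) (𝓝 1) := by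
    have h1 : Tendsto (fun x : ℝ => 1 + √x * (Real.pi / 2)) (𝓝[>] 0) (𝓝 1) := by
      simpa using hsqrt.const_add 1
    refine tendsto_of_tendsto_of_tendsto_of_le_of_le' tendsto_const_nhds h1 ?_ ?_
    · filter_upwards [hev] with x hx using (paramE_one_sub_bounds hx.1).1
    · filter_upwards [hev] with x hx using (paramE_one_sub_bounds hx.1).2
  have hK : Tendsto paramK (𝓝[>] 0) (𝓝 (Real.pi / 2)) := by
    rw [← hK0]
    exact (hasDerivAt_paramK one_pos).continuousAt.tendsto.mono_left nhdsWithin_le_nhds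
  have hB : Tendsto paramB (𝓝[>] 0) (𝓝 (paramB 0)) :=
    (hasDerivAt_ellipticJ (by fun_prop) _ one_pos).continuousAt.tendsto.mono_left nhdsWithin_le_nhds
  -- Writing `(1 - x) B(1 - x) = E(1 - x) - x K(1 - x)` leaves only terms with known limits.
  have hlim2 : Tendsto f (𝓝[>] 0) (𝓝 (paramB 0 * 0 + (1 - 0) * (Real.pi / 2))) := by
    refine ((hB.mul hmK).add ((hE.sub hmK).mul hK)).congr' ?_
    filter_upwards [hev] with x hx
    rw [paramE_eq (by linarith [hx.1])]
    simp only [f]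
    ring
  have := tendsto_nhds_unique hlim1 hlim2
  rw [mul_zero, zero_add, sub_zero, one_mul] at this
  exact this

/-! ### The branch point -/

/-- Substitute `μ = √(1 - m sin² t)` with `m = 1 - a²`. The equation defining `a(κ)` becomes `κ = m
B(m)`. -/
lemma branchIntegral_eq_paramB {a : ℝ} (ha : a ∈ Ioo (0 : ℝ) 1) :
    branchIntegral a = (1 - a ^ 2) * paramB (1 - a ^ 2) := by
  set m := 1 - a ^ 2 with hm
  have hm1 : m < 1 := by have := ha.1; rw [hm]; nlinarith
  have hm0 : 0 < m := by rw [hm]; nlinarith [ha.1, ha.2]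
  have hp := one_sub_mul_sin_sq_pos hm1
  have hsin : ∀ t ∈ Ioo 0 (Real.pi / 2), 0 < Real.sin t := fun t ht =>
    Real.sin_pos_of_pos_of_lt_pi ht.1 (by linarith [ht.2, Real.pi_pos])
  have hcos : ∀ t ∈ Ioo 0 (Real.pi / 2), 0 < Real.cos t := fun t ht =>
    Real.cos_pos_of_mem_Ioo ⟨by linarith [ht.1, Real.pi_pos], ht.2⟩
  have hder : ∀ t ∈ Ioo 0 (Real.pi / 2), HasDerivWithinAt (fun t => √(1 - m * Real.sin t ^ 2))
      (-(m * (2 * Real.sin t * Real.cos t)) / (2 * √(1 - m * Real.sin t ^ 2)))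
      (Ioo 0 (Real.pi / 2)) t := by
    intro t _
    have h3 : HasDerivAt (fun t => 1 - m * Real.sin t ^ 2)
        (-(m * (2 * Real.sin t * Real.cos t))) t := by
      simpa using (((Real.hasDerivAt_sin t).pow 2).const_mul m).const_sub 1
    exact (h3.sqrt (hp t).ne').hasDerivWithinAt
  have hinj : InjOn (fun t => √(1 - m * Real.sin t ^ 2)) (Ioo 0 (Real.pi / 2)) := by
    intro x hx y hy hxy
    have h1 := (Real.sqrt_inj (hp x).le (hp y).le).1 hxy
    have h2 : Real.sin x ^ 2 = Real.sin y ^ 2 := by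
      have : m * Real.sin x ^ 2 = m * Real.sin y ^ 2 := by linarith
      exact mul_left_cancel₀ hm0.ne' this
    have h3 : Real.sin x = Real.sin y :=
      (pow_left_inj₀ (hsin x hx).le (hsin y hy).le two_ne_zero).1 h2
    exact Real.injOn_sin ⟨by linarith [hx.1, Real.pi_pos], hx.2.le⟩
      ⟨by linarith [hy.1, Real.pi_pos], hy.2.le⟩ h3
  have himg : (fun t => √(1 - m * Real.sin t ^ 2)) '' Ioo 0 (Real.pi / 2) = Ioo a 1 := by
    ext μ
    constructor
    · rintro ⟨t, ht, rfl⟩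
      have h1 := hsin t ht
      have h2 := hcos t ht
      have h3 := Real.sin_sq_add_cos_sq t
      have h4 : 0 < m * Real.sin t ^ 2 := by positivity
      have h5 : 0 < m * Real.cos t ^ 2 := by positivity
      constructor
      · refine Real.lt_sqrt_of_sq_lt ?_
        nlinarith
      · rw [Real.sqrt_lt' one_pos]
        linarith
    · intro hμ
      have hμ0 : 0 < μ := ha.1.trans hμ.1
      have h1 : 0 < (1 - μ ^ 2) / m := div_pos (by nlinarith [hμ.2]) hm0
      have h2 : (1 - μ ^ 2) / m < 1 := by
        rw [div_lt_one hm0, hm]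
        nlinarith [hμ.1, ha.1]
      have h3 : √((1 - μ ^ 2) / m) < 1 := by rwa [Real.sqrt_lt' one_pos, one_pow]
      have h4 := Real.sqrt_pos.2 h1
      refine ⟨Real.arcsin √((1 - μ ^ 2) / m), ⟨Real.arcsin_pos.2 h4,
        Real.arcsin_lt_pi_div_two.2 h3⟩, ?_⟩
      simp only
      rw [Real.sin_arcsin (by linarith) h3.le, Real.sq_sqrt h1.le, mul_div_cancel₀ _ hm0.ne',
        sub_sub_cancel, Real.sqrt_sq hμ0.le]
  rw [branchIntegral, intervalIntegral.integral_of_le ha.2.le, integral_Ioc_eq_integral_Ioo, ← himg,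
    integral_image_eq_integral_abs_deriv_smul measurableSet_Ioo hder hinj, paramB, ellipticJ,
    intervalIntegral.integral_of_le (by positivity), integral_Ioc_eq_integral_Ioo,
    ← integral_const_mul]
  refine setIntegral_congr_fun measurableSet_Ioo fun t ht => ?_
  have h1 := hsin t ht
  have h2 := hcos t ht
  have h3 := Real.sqrt_pos.2 (hp t)
  have hq : ((√(1 - m * Real.sin t ^ 2)) ^ 2 - a ^ 2) / (1 - (√(1 - m * Real.sin t ^ 2)) ^ 2) =
      (Real.cos t / Real.sin t) ^ 2 := by
    rw [Real.sq_sqrt (hp t).le, sub_sub_cancel, show a ^ 2 = 1 - m by rw [hm]; ring, div_pow,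
      Real.cos_sq']
    field_simp
    ring
  rw [hq, Real.sqrt_sq (by positivity), neg_div, abs_neg, abs_of_pos (by positivity), smul_eq_mul,
    neg_div, Real.rpow_neg (hp t).le, ← Real.sqrt_eq_rpow]
  field_simp

/-- The complementary parameter `1 - a(κ)²`. -/
def branchParam (κ : ℝ) : ℝ := 1 - branchPoint κ ^ 2

lemma branchParam_mem {κ : ℝ} (hκ : κ ∈ Ioo (0 : ℝ) 1) : branchParam κ ∈ Ioo (0 : ℝ) 1 := by
  obtain ⟨⟨h0, h1⟩, -⟩ := branchPoint_spec hκ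
  constructor <;> rw [branchParam] <;> nlinarith

lemma branchParam_mul_paramB {κ : ℝ} (hκ : κ ∈ Ioo (0 : ℝ) 1) :
    branchParam κ * paramB (branchParam κ) = κ := by
  obtain ⟨h, hb⟩ := branchPoint_spec hκ
  rw [branchParam, ← branchIntegral_eq_paramB h, ← hb]

lemma branchPoint_eq_sqrt {κ : ℝ} (hκ : κ ∈ Ioo (0 : ℝ) 1) :
    branchPoint κ = √(1 - branchParam κ) := by
  rw [branchParam, sub_sub_cancel, Real.sqrt_sq (branchPoint_spec hκ).1.1.le]

lemma strictMonoOn_mul_paramB : StrictMonoOn (fun m => m * paramB m) (Iio 1) := by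
  refine strictMonoOn_of_deriv_pos (convex_Iio 1)
    (fun m hm => (hasDerivAt_mul_paramB hm).continuousAt.continuousWithinAt) fun m hm => ?_
  rw [interior_Iio] at hm
  rw [(hasDerivAt_mul_paramB hm).deriv]
  exact half_pos (paramK_pos hm)

lemma strictMonoOn_branchParam : StrictMonoOn branchParam (Ioo 0 1) := by
  intro x hx y hy hxy
  rw [← branchParam_mul_paramB hx, ← branchParam_mul_paramB hy] at hxy
  exact (strictMonoOn_mul_paramB.lt_iff_lt (branchParam_mem hx).2 (branchParam_mem hy).2).1 hxy

lemma image_branchParam : branchParam '' Ioo 0 1 = Ioo 0 1 := by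
  refine Subset.antisymm (image_subset_iff.2 fun κ hκ => branchParam_mem hκ) fun m hm => ?_
  have ha : √(1 - m) ∈ Ioo (0 : ℝ) 1 := by
    refine ⟨Real.sqrt_pos.2 (by linarith [hm.2]), ?_⟩
    rw [Real.sqrt_lt' one_pos]
    linarith [hm.1]
  have hsq : 1 - √(1 - m) ^ 2 = m := by
    rw [Real.sq_sqrt (by linarith [hm.2])]
    ring
  have hκ : m * paramB m ∈ Ioo (0 : ℝ) 1 := by
    have h := branchIntegral_eq_paramB ha
    rw [hsq] at h
    rw [← h]
    have h0 := strictAntiOn_branchIntegral (left_mem_Icc.2 zero_le_one) (Ioo_subset_Icc_self ha) ha.1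
    have h1 := strictAntiOn_branchIntegral (Ioo_subset_Icc_self ha) (right_mem_Icc.2 zero_le_one)
      ha.2
    rw [branchIntegral_zero] at h0
    rw [branchIntegral_one] at h1
    exact ⟨h1, h0⟩
  refine ⟨m * paramB m, hκ, ?_⟩
  exact strictMonoOn_mul_paramB.injOn (branchParam_mem hκ).2 hm.2 (branchParam_mul_paramB hκ)

/-- `branchParam` inverts `m ↦ m B(m)`, whose derivative is `K/2`; continuity holds because it is
strictly monotone with open image. -/
lemma hasDerivAt_branchParam {κ : ℝ} (hκ : κ ∈ Ioo (0 : ℝ) 1) :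
    HasDerivAt branchParam (2 / paramK (branchParam κ)) κ := by
  have hm := branchParam_mem hκ
  have hc : ContinuousAt branchParam κ :=
    strictMonoOn_branchParam.continuousAt_of_image_mem_nhds (isOpen_Ioo.mem_nhds hκ)
      (by rw [image_branchParam]; exact isOpen_Ioo.mem_nhds hm)
  refine (HasDerivAt.of_local_left_inverse hc (hasDerivAt_mul_paramB hm.2)
    (half_pos (paramK_pos hm.2)).ne' ?_).congr_deriv (by rw [inv_div])
  filter_upwards [isOpen_Ioo.mem_nhds hκ] with x hx using branchParam_mul_paramB hx

lemma ellipticK_branchPoint {κ : ℝ} (hκ : κ ∈ Ioo (0 : ℝ) 1) :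
    ellipticK (branchPoint κ) = paramK (1 - branchParam κ) :=
  ellipticK_eq_paramK (by rw [branchParam]; ring) (by linarith [(branchParam_mem hκ).1])

lemma ellipticK_coBranchPoint {κ : ℝ} (hκ : κ ∈ Ioo (0 : ℝ) 1) :
    ellipticK (coBranchPoint κ) = paramK (branchParam κ) :=
  ellipticK_eq_paramK (by rw [coBranchPoint, ← branchParam, Real.sq_sqrt (branchParam_mem hκ).1.le])
    (branchParam_mem hκ).2

lemma freqV_eq {κ : ℝ} (hκ : κ ∈ Ioo (0 : ℝ) 1) :
    freqV κ = -(2 / Real.pi) * ((1 - branchParam κ) * paramB (1 - branchParam κ)) := by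
  have hE : ellipticE (branchPoint κ) = paramE (1 - branchParam κ) :=
    ellipticE_eq_paramE (by rw [branchParam]; ring)
  rw [freqV, ellipticK_branchPoint hκ, hE, paramE_eq (by linarith [(branchParam_mem hκ).1])]
  rw [branchParam]
  ring

/-- The half-period ratio `K(a) / K(a')`. -/
def periodRatio (κ : ℝ) : ℝ := paramK (1 - branchParam κ) / paramK (branchParam κ)

lemma hasDerivAt_one_sub_branchParam {κ : ℝ} (hκ : κ ∈ Ioo (0 : ℝ) 1) :
    HasDerivAt (fun κ => 1 - branchParam κ) (-(2 / paramK (branchParam κ))) κ :=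
  (hasDerivAt_branchParam hκ).const_sub 1

lemma hasDerivAt_freqV {κ : ℝ} (hκ : κ ∈ Ioo (0 : ℝ) 1) :
    HasDerivAt freqV (2 / Real.pi * periodRatio κ) κ := by
  have hm := branchParam_mem hκ
  have h1 := ((hasDerivAt_mul_paramB (by linarith [hm.1] : 1 - branchParam κ < 1)).comp κ
    (hasDerivAt_one_sub_branchParam hκ)).const_mul (-(2 / Real.pi))
  refine (h1.congr_deriv ?_).congr_of_eventuallyEq ?_
  · have := (paramK_pos hm.2).ne'
    rw [periodRatio]
    field_simp
  · filter_upwards [isOpen_Ioo.mem_nhds hκ] with x hx using freqV_eq hx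

/-- Legendre's relation, as a Wronskian identity for the frequency. -/
lemma freqV_sub_mul_deriv {κ : ℝ} (hκ : κ ∈ Ioo (0 : ℝ) 1) :
    freqV κ - κ * (2 / Real.pi * periodRatio κ) = -(1 / paramK (branchParam κ)) := by
  have hm := branchParam_mem hκ
  have hK := (paramK_pos hm.2).ne'
  have hL := legendre_relation hm
  rw [branchParam_mul_paramB hκ] at hL
  have hpi := Real.pi_ne_zero
  rw [freqV_eq hκ, periodRatio]
  field_simp
  linarith

/-- The numerator of the quotient rule is the left side of Legendre's relation. -/
lemma hasDerivAt_periodRatio {κ : ℝ} (hκ : κ ∈ Ioo (0 : ℝ) 1) :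
    HasDerivAt periodRatio (-(Real.pi / (2 * branchParam κ * (1 - branchParam κ) *
      paramK (branchParam κ) ^ 3))) κ := by
  have hm := branchParam_mem hκ
  have hK := (paramK_pos hm.2).ne'
  have hL := legendre_relation hm
  have h0 := hm.1.ne'
  have h1 : 1 - branchParam κ ≠ 0 := by linarith [hm.2]
  have hA : HasDerivAt (fun κ => paramK (1 - branchParam κ)) _ κ :=
    (hasDerivAt_paramK (by linarith [hm.1] : 1 - branchParam κ < 1)).comp κ
      (hasDerivAt_one_sub_branchParam hκ)
  have hB : HasDerivAt (fun κ => paramK (branchParam κ)) _ κ :=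
    (hasDerivAt_paramK hm.2).comp κ (hasDerivAt_branchParam hκ)
  refine (hA.div hB hK).congr_deriv ?_
  rw [sub_sub_cancel]
  field_simp
  linarith

lemma periodRatio_pos {κ : ℝ} (hκ : κ ∈ Ioo (0 : ℝ) 1) : 0 < periodRatio κ :=
  div_pos (paramK_pos (by linarith [(branchParam_mem hκ).1])) (paramK_pos (branchParam_mem hκ).2)

lemma tau_eq {κ : ℝ} (hκ : κ ∈ Ioo (0 : ℝ) 1) : tau κ = 2 * Complex.I * (periodRatio κ : ℂ) := by
  rw [tau, ellipticK_branchPoint hκ, ellipticK_coBranchPoint hκ, periodRatio]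
  push_cast
  ring

lemma tau_im_pos {κ : ℝ} (hκ : κ ∈ Ioo (0 : ℝ) 1) : 0 < (tau κ).im := by
  rw [tau_eq hκ]
  simpa using periodRatio_pos hκ

lemma deriv_tau {κ : ℝ} (hκ : κ ∈ Ioo (0 : ℝ) 1) :
    deriv tau κ = 2 * Complex.I * ((-(Real.pi / (2 * branchParam κ * (1 - branchParam κ) *
      paramK (branchParam κ) ^ 3)) : ℝ) : ℂ) := by
  have h : HasDerivAt tau _ κ := ((hasDerivAt_periodRatio hκ).ofReal_comp.const_mul
    (2 * Complex.I)).congr_of_eventuallyEq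
      ((isOpen_Ioo.eventually_mem hκ).mono fun x hx => tau_eq hx)
  exact h.deriv

/-- The nome `e^{iπτ/2}`. -/
def nome (κ : ℝ) : ℝ := Real.exp (-(Real.pi * periodRatio κ))

lemma ofReal_nome {κ : ℝ} (hκ : κ ∈ Ioo (0 : ℝ) 1) :
    (nome κ : ℂ) = Complex.exp (Real.pi * Complex.I * tau κ / 2) := by
  rw [nome, tau_eq hκ, Complex.ofReal_exp]
  congr 1
  push_cast
  linear_combination (-(Real.pi * periodRatio κ) : ℂ) * Complex.I_sq

lemma nome_pos (κ : ℝ) : 0 < nome κ := Real.exp_pos _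

lemma nome_lt_one {κ : ℝ} (hκ : κ ∈ Ioo (0 : ℝ) 1) : nome κ < 1 := by
  rw [nome, Real.exp_lt_one_iff]
  have := mul_pos Real.pi_pos (periodRatio_pos hκ)
  linarith

/-- The logarithmic derivative `κ d/dκ log nome`, as a function of the parameter. -/
def nomeRate (m : ℝ) : ℝ := Real.pi ^ 2 * paramB m / (2 * (1 - m) * paramK m ^ 3)

/-- The factor `1/m` in the derivative of `periodRatio` is absorbed by `κ = m B(m)`, so `nomeRate`
is continuous at `m = 0`. -/
lemma hasDerivAt_nome {κ : ℝ} (hκ : κ ∈ Ioo (0 : ℝ) 1) :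
    HasDerivAt nome (nome κ * nomeRate (branchParam κ) / κ) κ := by
  have hm := branchParam_mem hκ
  have hK := (paramK_pos hm.2).ne'
  have h0 := hm.1.ne'
  have h1 : 1 - branchParam κ ≠ 0 := by linarith [hm.2]
  have hB := (paramB_pos hm.2).ne'
  refine ((hasDerivAt_periodRatio hκ).const_mul Real.pi).fun_neg.exp.congr_deriv ?_
  have hr : nomeRate (branchParam κ) = κ * (Real.pi * (Real.pi /
      (2 * branchParam κ * (1 - branchParam κ) * paramK (branchParam κ) ^ 3))) := by
    calc nomeRate (branchParam κ) = branchParam κ * paramB (branchParam κ) * (Real.pi * (Real.pi /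
        (2 * branchParam κ * (1 - branchParam κ) * paramK (branchParam κ) ^ 3))) := by
          rw [nomeRate]
          field_simp
      _ = _ := by rw [branchParam_mul_paramB hκ]
  rw [hr, mul_left_comm, mul_div_cancel_left₀ _ hκ.1.ne', nome]
  ring

/-! ### The amplitude as a function of the phase, the nome and the elliptic parameter -/

/-- `Ξ₀` in terms of the phase and the nome. -/
def amplXi0 (x p : ℝ) : ℂ :=
  2 * (thetaSeries 0 0 0 p ^ 2 / thetaSeries 0 0 x p ^ 2) *
    (thetaSeries (-1) 0 (x + 1 / 2) p * thetaSeries 1 0 (x + 1 / 2) p /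
      thetaSeries (-1) 0 (1 / 2) p ^ 2)

/-- `Ξ₂` in terms of the phase and the nome. -/
def amplXi2 (x p : ℝ) : ℂ :=
  2 * (thetaSeries 0 0 0 p ^ 2 / thetaSeries 0 0 x p ^ 2) *
    (thetaSeries 1 0 x p * thetaSeries (-1) 0 x p / thetaSeries 1 0 0 p ^ 2)

/-- The normalized `k`-th derivative of the theta series. -/
def thetaQuot (j : ℤ) (k : ℕ) (y p : ℝ) : ℂ := thetaSeries j k y p / thetaSeries j 0 y p

/-- `Θ₀` in terms of the phase, the nome and the elliptic parameter. -/
def amplTheta0 (x p m : ℝ) : ℂ :=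
  let a : ℂ := (√(1 - m) : ℝ)
  let c : ℂ := Complex.I / 2 * (1 / (paramK m : ℂ))
  5 * c ^ 2 * (thetaQuot (-1) 2 (x + 1 / 2) p -
      2 * (thetaQuot (-1) 2 (1 / 2) p - thetaQuot (-1) 1 (1 / 2) p ^ 2) +
      thetaQuot 1 2 (x + 1 / 2) p)
    + 14 * c ^ 2 * thetaQuot 1 1 (x + 1 / 2) p * thetaQuot (-1) 1 (x + 1 / 2) p
    - 4 * c ^ 2 * (thetaQuot 1 1 (x + 1 / 2) p + thetaQuot (-1) 1 (1 / 2) p -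
      thetaQuot (-1) 1 (x + 1 / 2) p) * thetaQuot (-1) 1 (1 / 2) p
    - 2 * c * (1 + a) * (thetaQuot (-1) 1 (x + 1 / 2) p - 2 * thetaQuot (-1) 1 (1 / 2) p -
      thetaQuot 1 1 (x + 1 / 2) p)
    - 2 * (2 + a)

/-- `M` in terms of the phase, the nome and the elliptic parameter. -/
def ampl (q : ℝ × ℝ × ℝ) : ℂ :=
  (amplXi0 q.1 q.2.1 * amplTheta0 q.1 q.2.1 q.2.2 +
      6 * ((√(1 - q.2.2) : ℝ) : ℂ) * amplXi2 q.1 q.2.1) /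
      (48 * ((√(1 - q.2.2) : ℝ) : ℂ) * (1 + ((√(1 - q.2.2) : ℝ) : ℂ)))
    + 1 / 4 * thetaQuot 0 2 q.1 q.2.1 *
      ((paramB q.2.2 / ((1 - q.2.2) * paramK q.2.2 ^ 3) : ℝ) : ℂ)

/-- The half-period shift in `theta2` moves the arguments `x ∓ τ/4` to `x + τ/4` and `x + 3τ/4`.
Quasi-periodicity brings the latter back to `x - τ/4`, and the exponential factors cancel. -/
lemma theta2_mul_theta2 (x : ℝ) {τ : ℂ} {p : ℝ}
    (hp : (p : ℂ) = Complex.exp (Real.pi * Complex.I * τ / 2)) :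
    theta2 (x + -τ / 4) τ * theta2 (x - -τ / 4) τ =
      thetaSeries 1 0 x p * thetaSeries (-1) 0 x p := by
  rw [← thetaDeriv_eq_thetaSeries (j := 1) (by norm_num) 0 x hp,
    ← thetaDeriv_eq_thetaSeries (j := -1) (by norm_num) 0 x hp, thetaDeriv_zero, thetaDeriv_zero,
    theta2, theta2, theta3, theta3, theta3, theta3,
    show (x : ℂ) - -τ / 4 + τ / 2 = (x + ((-1 : ℤ) : ℂ) * τ / 4) + τ by push_cast; ring,
    show (x : ℂ) + -τ / 4 + τ / 2 = x + ((1 : ℤ) : ℂ) * τ / 4 by push_cast; ring,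
    jacobiTheta₂_add_left']
  have h : Complex.exp (Complex.I * Real.pi / 4 * τ + Complex.I * Real.pi * (x + -τ / 4)) *
      (Complex.exp (Complex.I * Real.pi / 4 * τ + Complex.I * Real.pi * (x - -τ / 4)) *
      Complex.exp (-Real.pi * Complex.I * (τ + 2 * (x + ((-1 : ℤ) : ℂ) * τ / 4)))) = 1 := by
    rw [← Complex.exp_add, ← Complex.exp_add, ← Complex.exp_zero]
    congr 1
    push_cast
    ring
  linear_combination (jacobiTheta₂ (x + ((1 : ℤ) : ℂ) * τ / 4) τ *
    jacobiTheta₂ (x + ((-1 : ℤ) : ℂ) * τ / 4) τ) * h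

lemma theta2_quarter {τ : ℂ} {p : ℝ} (hp : (p : ℂ) = Complex.exp (Real.pi * Complex.I * τ / 2)) :
    theta2 (-τ / 4) τ = thetaSeries 1 0 0 p := by
  rw [← thetaDeriv_eq_thetaSeries (j := 1) (by norm_num) 0 0 hp, thetaDeriv_zero, theta2,
    show Complex.I * Real.pi / 4 * τ + Complex.I * Real.pi * (-τ / 4) = 0 by ring, Complex.exp_zero,
    one_mul]
  congr 1
  push_cast
  ring

lemma M_eq_ampl (x : ℝ) {κ : ℝ} (hκ : κ ∈ Ioo (0 : ℝ) 1) :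
    M x κ = ampl (x, nome κ, branchParam κ) := by
  have hp := ofReal_nome hκ
  have hτ := tau_im_pos hκ
  have hp0 := (nome_pos κ).le
  have hp1 := nome_lt_one hκ
  have ha : branchPoint κ = √(1 - branchParam κ) := branchPoint_eq_sqrt hκ
  have hT : ∀ k, ∀ y : ℝ, thetaDeriv k y (tau κ) = thetaSeries 0 k y (nome κ) := fun k y => by
    rw [← thetaDeriv_eq_thetaSeries (j := 0) (by norm_num) k y hp]
    simp
  have hA : ∀ k, thetaDeriv k (x + -tau κ / 4 + 1 / 2) (tau κ) =
      thetaSeries (-1) k (x + 1 / 2) (nome κ) := fun k => by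
    rw [← thetaDeriv_eq_thetaSeries (j := -1) (by norm_num) k _ hp]
    congr 1; push_cast; ring
  have hB : ∀ k, thetaDeriv k (x - -tau κ / 4 + 1 / 2) (tau κ) =
      thetaSeries 1 k (x + 1 / 2) (nome κ) := fun k => by
    rw [← thetaDeriv_eq_thetaSeries (j := 1) (by norm_num) k _ hp]
    congr 1; push_cast; ring
  have hD : ∀ k, thetaDeriv k (-tau κ / 4 + 1 / 2) (tau κ) =
      thetaSeries (-1) k (1 / 2) (nome κ) := fun k => by
    rw [← thetaDeriv_eq_thetaSeries (j := -1) (by norm_num) k _ hp]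
    congr 1; push_cast; ring
  have hD0 : thetaDeriv 0 (-tau κ / 4 + 1 / 2) (tau κ) ≠ 0 := by
    rw [hD]; exact thetaSeries_ne_zero (by norm_num) _ hp0 hp1
  have h30 : theta3 0 (tau κ) = thetaSeries 0 0 0 (nome κ) := by
    rw [← thetaDeriv_zero, ← hT, Complex.ofReal_zero]
  have h3x : theta3 x (tau κ) = thetaSeries 0 0 x (nome κ) := by
    rw [← thetaDeriv_zero, ← hT]
  have hXi0 : Xi0 x κ = amplXi0 x (nome κ) := by
    rw [Xi0, amplXi0, shiftD, h30, h3x, theta0, theta0, theta0, ← thetaDeriv_zero,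
      ← thetaDeriv_zero, ← thetaDeriv_zero, hA, hB, hD]
  have hXi2 : Xi2 x κ = amplXi2 x (nome κ) := by
    rw [Xi2, amplXi2, shiftD, h30, h3x, theta2_mul_theta2 x hp, theta2_quarter hp]
  have hTheta : Theta0 x κ = amplTheta0 x (nome κ) (branchParam κ) := by
    simp only [Theta0, amplTheta0, shiftD, normC, thetaQuot, logTheta0_eq hτ, secTheta0_eq hτ,
      hA, hB, hD, ha, ellipticK_coBranchPoint hκ]
    rw [← funext fun w => logTheta0_eq hτ w, deriv_logTheta0_eq hτ _ hD0, hD, hD, hD]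
  rw [M, ampl, hXi0, hXi2, hTheta, ha, iteratedDeriv_two_theta3 hτ, hT, h3x, deriv_tau hκ,
    thetaQuot]
  have hm := branchParam_mem hκ
  have hm0 : (branchParam κ : ℂ) ≠ 0 := by exact_mod_cast hm.1.ne'
  -- This removes the factor `1/m` from `κ dτ/dκ`, so that `ampl` makes sense at `m = 0`.
  have hκm : (κ : ℂ) = branchParam κ * paramB (branchParam κ) := by
    exact_mod_cast (branchParam_mul_paramB hκ).symm
  have hpi : (Real.pi : ℂ) ≠ 0 := by exact_mod_cast Real.pi_ne_zero
  have h1m : (1 - branchParam κ : ℂ) ≠ 0 := by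
    exact_mod_cast (sub_pos.2 hm.2).ne'
  have hK : (paramK (branchParam κ) : ℂ) ≠ 0 := by exact_mod_cast (paramK_pos hm.2).ne'
  have ht : thetaSeries 0 0 x (nome κ) ≠ 0 := thetaSeries_ne_zero (by norm_num) _ hp0 hp1
  congr 1
  push_cast
  set r := thetaSeries 0 2 x (nome κ)
  set t := thetaSeries 0 0 x (nome κ)
  set m := branchParam κ
  rw [hκm]
  field_simp
  linear_combination (-(paramB m * r)) * Complex.I_sq

/-! ### Regularity of the amplitude, including the degenerate point. -/

lemma contDiffAt_div {E : Type*} [NormedAddCommGroup E] [NormedSpace ℝ E] {f g : E → ℂ} {x : E}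
    (hf : ContDiffAt ℝ 1 f x) (hg : ContDiffAt ℝ 1 g x) (h0 : g x ≠ 0) :
    ContDiffAt ℝ 1 (fun y => f y / g y) x := by
  simp only [div_eq_mul_inv]
  exact hf.mul (hg.inv h0)

lemma contDiffAt_one_of_hasDerivAt {f f' : ℝ → ℝ} {U : Set ℝ} (hU : IsOpen U)
    (hf : ∀ x ∈ U, HasDerivAt f (f' x) x) (hf' : ContinuousOn f' U) {x : ℝ} (hx : x ∈ U) :
    ContDiffAt ℝ 1 f x :=
  contDiffAt_one_iff.2 ⟨_, U, hU.mem_nhds hx,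
    (ContinuousLinearMap.smulRightL ℝ ℝ ℝ 1).continuous.comp_continuousOn hf',
    fun y hy => (hf y hy).hasFDerivAt⟩

lemma contDiffAt_ellipticJ {w : ℝ → ℝ} (hw : Continuous w) (r : ℝ) {m : ℝ} (hm : m < 1) :
    ContDiffAt ℝ 1 (ellipticJ w r) m :=
  contDiffAt_one_of_hasDerivAt isOpen_Iio (fun _ hx => hasDerivAt_ellipticJ hw r hx)
    (fun _ hx => (hasDerivAt_ellipticJ (w := fun t => -r * Real.sin t ^ 2 * w t) (by fun_prop)
      (r - 1) hx).continuousAt.continuousWithinAt) hm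

lemma contDiffAt_thetaSeries_comp {j : ℤ} (hj : |j| ≤ 1) (k : ℕ) {f : ℝ × ℝ × ℝ → ℝ}
    (hf : ContDiff ℝ 1 f) {q : ℝ × ℝ × ℝ} (hq : |q.2.1| < 1) :
    ContDiffAt ℝ 1 (fun q : ℝ × ℝ × ℝ => thetaSeries j k (f q) q.2.1) q :=
  ContDiffAt.comp (f := fun q : ℝ × ℝ × ℝ => (f q, q.2.1)) q
    (contDiffAt_thetaSeries hj k (f q) hq) (hf.contDiffAt.prodMk (by fun_prop))

lemma contDiffAt_thetaQuot_comp {j : ℤ} (hj : |j| ≤ 1) (k : ℕ) {f : ℝ × ℝ × ℝ → ℝ}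
    (hf : ContDiff ℝ 1 f) {q : ℝ × ℝ × ℝ} (hq0 : 0 ≤ q.2.1) (hq1 : q.2.1 < 1) :
    ContDiffAt ℝ 1 (fun q : ℝ × ℝ × ℝ => thetaQuot j k (f q) q.2.1) q := by
  have hq : |q.2.1| < 1 := by rwa [abs_of_nonneg hq0]
  exact contDiffAt_div (contDiffAt_thetaSeries_comp hj k hf hq)
    (contDiffAt_thetaSeries_comp hj 0 hf hq) (thetaSeries_ne_zero hj _ hq0 hq1)

lemma contDiffAt_amplXi0 {q : ℝ × ℝ × ℝ} (hq0 : 0 ≤ q.2.1) (hq1 : q.2.1 < 1) :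
    ContDiffAt ℝ 1 (fun q : ℝ × ℝ × ℝ => amplXi0 q.1 q.2.1) q := by
  have hq : |q.2.1| < 1 := by rwa [abs_of_nonneg hq0]
  have hn := fun j hj y => thetaSeries_ne_zero (j := j) hj y hq0 hq1
  have hc := fun j hj (f : ℝ × ℝ × ℝ → ℝ) hf => contDiffAt_thetaSeries_comp (j := j) hj 0 (f := f) hf hq
  refine (contDiffAt_const.mul (contDiffAt_div ((hc 0 (by norm_num) _ contDiff_const).pow 2)
    ((hc 0 (by norm_num) _ contDiff_fst).pow 2) (pow_ne_zero 2 (hn _ (by norm_num) _)))).mul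
    (contDiffAt_div ((hc (-1) (by norm_num) _ ?_).mul (hc 1 (by norm_num) _ ?_))
      ((hc (-1) (by norm_num) _ contDiff_const).pow 2) (pow_ne_zero 2 (hn _ (by norm_num) _)))
  all_goals fun_prop

lemma contDiffAt_amplXi2 {q : ℝ × ℝ × ℝ} (hq0 : 0 ≤ q.2.1) (hq1 : q.2.1 < 1) :
    ContDiffAt ℝ 1 (fun q : ℝ × ℝ × ℝ => amplXi2 q.1 q.2.1) q := by
  have hq : |q.2.1| < 1 := by rwa [abs_of_nonneg hq0]
  have hn := fun j hj y => thetaSeries_ne_zero (j := j) hj y hq0 hq1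
  have hc := fun j hj (f : ℝ × ℝ × ℝ → ℝ) hf => contDiffAt_thetaSeries_comp (j := j) hj 0 (f := f) hf hq
  exact (contDiffAt_const.mul (contDiffAt_div ((hc 0 (by norm_num) _ contDiff_const).pow 2)
    ((hc 0 (by norm_num) _ contDiff_fst).pow 2) (pow_ne_zero 2 (hn _ (by norm_num) _)))).mul
    (contDiffAt_div ((hc 1 (by norm_num) _ contDiff_fst).mul (hc (-1) (by norm_num) _ contDiff_fst))
      ((hc 1 (by norm_num) _ contDiff_const).pow 2) (pow_ne_zero 2 (hn _ (by norm_num) _)))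

lemma contDiffAt_ampl {q : ℝ × ℝ × ℝ} (hq0 : 0 ≤ q.2.1) (hq1 : q.2.1 < 1) (hm : q.2.2 < 1) :
    ContDiffAt ℝ 1 ampl q := by
  have hT := fun j hj k (f : ℝ × ℝ × ℝ → ℝ) hf =>
    contDiffAt_thetaQuot_comp (j := j) hj k (f := f) hf hq0 hq1
  have hA : ∀ k, ContDiffAt ℝ 1 (fun q : ℝ × ℝ × ℝ => thetaQuot (-1) k (q.1 + 1 / 2) q.2.1) q :=
    fun k => hT (-1) (by norm_num) k _ (by fun_prop)
  have hB : ∀ k, ContDiffAt ℝ 1 (fun q : ℝ × ℝ × ℝ => thetaQuot 1 k (q.1 + 1 / 2) q.2.1) q :=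
    fun k => hT 1 (by norm_num) k _ (by fun_prop)
  have hD : ∀ k, ContDiffAt ℝ 1 (fun q : ℝ × ℝ × ℝ => thetaQuot (-1) k (1 / 2) q.2.1) q :=
    fun k => hT (-1) (by norm_num) k _ contDiff_const
  have hX : ContDiffAt ℝ 1 (fun q : ℝ × ℝ × ℝ => thetaQuot 0 2 q.1 q.2.1) q :=
    hT 0 (by norm_num) 2 _ contDiff_fst
  have hre : ∀ {f : ℝ × ℝ × ℝ → ℝ}, ContDiffAt ℝ 1 f q →
      ContDiffAt ℝ 1 (fun q => (f q : ℂ)) q := fun hf =>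
    Complex.ofRealCLM.contDiff.contDiffAt.comp q hf
  have h1m : 0 < 1 - q.2.2 := sub_pos.2 hm
  have hs : ContDiffAt ℝ 1 (fun q : ℝ × ℝ × ℝ => ((√(1 - q.2.2) : ℝ) : ℂ)) q :=
    hre (ContDiffAt.sqrt (by fun_prop) h1m.ne')
  have hs0 := Real.sqrt_pos.2 h1m
  have hKr : ContDiffAt ℝ 1 (fun q : ℝ × ℝ × ℝ => paramK q.2.2) q :=
    ContDiffAt.comp (f := fun q : ℝ × ℝ × ℝ => q.2.2) q
      (contDiffAt_ellipticJ continuous_const (-1 / 2) hm) (by fun_prop)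
  have hBr : ContDiffAt ℝ 1 (fun q : ℝ × ℝ × ℝ => paramB q.2.2) q :=
    ContDiffAt.comp (f := fun q : ℝ × ℝ × ℝ => q.2.2) q
      (contDiffAt_ellipticJ (by fun_prop) (-1 / 2) hm) (by fun_prop)
  have hK0 := paramK_pos hm
  have hc : ContDiffAt ℝ 1 (fun q : ℝ × ℝ × ℝ => Complex.I / 2 * (1 / (paramK q.2.2 : ℂ))) q :=
    contDiffAt_const.mul (contDiffAt_div contDiffAt_const (hre hKr) (by exact_mod_cast hK0.ne'))
  have hR : ContDiffAt ℝ 1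
      (fun q : ℝ × ℝ × ℝ => ((paramB q.2.2 / ((1 - q.2.2) * paramK q.2.2 ^ 3) : ℝ) : ℂ)) q :=
    hre (hBr.div (ContDiffAt.mul (by fun_prop) (hKr.pow 3)) (by positivity))
  have hTh : ContDiffAt ℝ 1 (fun q : ℝ × ℝ × ℝ => amplTheta0 q.1 q.2.1 q.2.2) q := by
    have key : ∀ a c A₁ A₂ B₁ B₂ D₁ D₂ : ℝ × ℝ × ℝ → ℂ, ContDiffAt ℝ 1 a q → ContDiffAt ℝ 1 c q →
        ContDiffAt ℝ 1 A₁ q → ContDiffAt ℝ 1 A₂ q → ContDiffAt ℝ 1 B₁ q → ContDiffAt ℝ 1 B₂ q →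
        ContDiffAt ℝ 1 D₁ q → ContDiffAt ℝ 1 D₂ q → ContDiffAt ℝ 1 (fun q =>
          5 * c q ^ 2 * (A₂ q - 2 * (D₂ q - D₁ q ^ 2) + B₂ q) + 14 * c q ^ 2 * B₁ q * A₁ q
            - 4 * c q ^ 2 * (B₁ q + D₁ q - A₁ q) * D₁ q
            - 2 * c q * (1 + a q) * (A₁ q - 2 * D₁ q - B₁ q) - 2 * (2 + a q)) q := by
      intros
      fun_prop
    exact key _ _ _ _ _ _ _ _ hs hc (hA 1) (hA 2) (hB 1) (hB 2) (hD 1) (hD 2)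
  refine ContDiffAt.add (contDiffAt_div (((contDiffAt_amplXi0 hq0 hq1).mul hTh).add
    ((contDiffAt_const.mul hs).mul (contDiffAt_amplXi2 hq0 hq1)))
    ((contDiffAt_const.mul hs).mul (contDiffAt_const.add hs)) ?_)
    ((contDiffAt_const.mul hX).mul hR)
  exact_mod_cast (by positivity : 48 * √(1 - q.2.2) * (1 + √(1 - q.2.2)) ≠ 0)

lemma ampl_add_one (x p m : ℝ) : ampl (x + 1, p, m) = ampl (x, p, m) := by
  simp only [ampl, amplXi0, amplXi2, amplTheta0, thetaQuot, add_right_comm x 1 (1 / 2),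
    thetaSeries_add_one]

/-- At `p = m = 0` one has `a = 1`, `Ξ₀ = Ξ₂ = 2`, `Θ₀ = -6`, and the `θ₃''` term vanishes; the
numerator is `-12 + 12`. This cancellation is the source of the decay of `M` as `κ → 0`. -/
lemma ampl_zero (x : ℝ) : ampl (x, 0, 0) = 0 := by
  simp only [ampl, amplXi0, amplXi2, amplTheta0, thetaQuot]
  simp only [thetaSeries_zero (j := 0) (by norm_num), thetaSeries_zero (j := 1) (by norm_num),
    thetaSeries_zero (j := -1) (by norm_num)]
  norm_num

lemma continuousOn_paramK : ContinuousOn paramK (Iio 1) := fun _ hm =>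
  (hasDerivAt_paramK hm).continuousAt.continuousWithinAt

lemma continuousOn_paramB : ContinuousOn paramB (Iio 1) := fun _ hm =>
  (hasDerivAt_ellipticJ (by fun_prop) _ hm).continuousAt.continuousWithinAt

lemma continuousOn_nomeRate : ContinuousOn nomeRate (Iio 1) := by
  refine (continuousOn_const.mul continuousOn_paramB).div
    ((by fun_prop : ContinuousOn (fun m : ℝ => 2 * (1 - m)) (Iio 1)).mul (continuousOn_paramK.pow 3))
    fun m hm => ?_
  have := paramK_pos hm
  have : 0 < 1 - m := sub_pos.2 hm
  positivity

lemma nomeRate_pos {m : ℝ} (hm : m < 1) : 0 < nomeRate m := by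
  have := paramK_pos hm
  have := paramB_pos hm
  have : 0 < 1 - m := sub_pos.2 hm
  rw [nomeRate]
  positivity

lemma continuousOn_branchParam : ContinuousOn branchParam (Ioo 0 1) := fun _ h =>
  (hasDerivAt_branchParam h).continuousAt.continuousWithinAt

lemma contDiffAt_branchParam {u : ℝ} (hu : u ∈ Ioo (0 : ℝ) 1) : ContDiffAt ℝ 1 branchParam u :=
  contDiffAt_one_of_hasDerivAt isOpen_Ioo (fun _ => hasDerivAt_branchParam)
    (continuousOn_const.div (continuousOn_paramK.comp continuousOn_branchParam
      fun _ h => (branchParam_mem h).2) fun _ h => (paramK_pos (branchParam_mem h).2).ne') hu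

lemma contDiffAt_nome {u : ℝ} (hu : u ∈ Ioo (0 : ℝ) 1) : ContDiffAt ℝ 1 nome u :=
  contDiffAt_one_of_hasDerivAt isOpen_Ioo (fun _ => hasDerivAt_nome)
    (ContinuousOn.div (ContinuousOn.mul
      (fun _ h => (hasDerivAt_nome h).continuousAt.continuousWithinAt)
      (continuousOn_nomeRate.comp continuousOn_branchParam fun _ h => (branchParam_mem h).2))
      continuousOn_id fun _ h => h.1.ne') hu

lemma uncurry_M_eventuallyEq (x : ℝ) {u : ℝ} (hu : u ∈ Ioo (0 : ℝ) 1) :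
    Function.uncurry (fun (x u : ℝ) => M x u) =ᶠ[𝓝 (x, u)]
      fun q : ℝ × ℝ => ampl (q.1, nome q.2, branchParam q.2) := by
  have h : ∀ᶠ q : ℝ × ℝ in 𝓝 (x, u), q.2 ∈ Ioo (0 : ℝ) 1 :=
    continuous_snd.continuousAt.eventually (isOpen_Ioo.mem_nhds hu)
  exact h.mono fun q hq => M_eq_ampl q.1 hq

lemma contDiffAt_ampl_branch (x : ℝ) {u : ℝ} (hu : u ∈ Ioo (0 : ℝ) 1) :
    ContDiffAt ℝ 1 ampl (x, nome u, branchParam u) :=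
  contDiffAt_ampl (nome_pos u).le (nome_lt_one hu) (branchParam_mem hu).2

lemma contDiffAt_M (x : ℝ) {u : ℝ} (hu : u ∈ Ioo (0 : ℝ) 1) :
    ContDiffAt ℝ 1 (Function.uncurry fun (x u : ℝ) => M x u) (x, u) := by
  refine ContDiffAt.congr_of_eventuallyEq ?_ (uncurry_M_eventuallyEq x hu)
  refine ContDiffAt.comp (f := fun q : ℝ × ℝ => (q.1, nome q.2, branchParam q.2)) (x, u)
    (contDiffAt_ampl_branch x hu) (contDiffAt_fst.prodMk (ContDiffAt.prodMk ?_ ?_))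
  · exact ContDiffAt.comp (g := nome) (f := Prod.snd) (x, u) (contDiffAt_nome hu) contDiffAt_snd
  · exact ContDiffAt.comp (g := branchParam) (f := Prod.snd) (x, u) (contDiffAt_branchParam hu)
      contDiffAt_snd

/-- Multiplication by `u` cancels the `1/u` in the derivative of `nome`, leaving a direction vector
that stays bounded as `u → 0`. -/
lemma mul_fderiv_M (x : ℝ) {u : ℝ} (hu : u ∈ Ioo (0 : ℝ) 1) :
    u • fderiv ℝ (Function.uncurry fun (x u : ℝ) => M x u) (x, u) (0, 1) =
      fderiv ℝ ampl (x, nome u, branchParam u)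
        (0, nome u * nomeRate (branchParam u), u * (2 / paramK (branchParam u))) := by
  have h1 : HasFDerivAt (Function.uncurry fun (x u : ℝ) => M x u) _ (x, u) :=
    ((contDiffAt_M x hu).differentiableAt one_ne_zero).hasFDerivAt
  have h2 := h1.comp_hasDerivAt u ((hasDerivAt_const u x).prodMk (hasDerivAt_id u))
  have h3 := ((contDiffAt_ampl_branch x hu).differentiableAt one_ne_zero).hasFDerivAt.comp_hasDerivAt
    u ((hasDerivAt_const u x).prodMk ((hasDerivAt_nome hu).prodMk (hasDerivAt_branchParam hu)))
  have h4 := h2.unique (h3.congr_of_eventuallyEq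
    ((isOpen_Ioo.eventually_mem hu).mono fun w hw => M_eq_ampl x hw))
  rw [h4, ← map_smul]
  congr 1
  have := hu.1.ne'
  ext <;> simp
  field_simp

/-! ### Uniform bounds as `κ → 0` and conclusion. -/

lemma periodic_fract {α : Type*} {f : ℝ → α} (hf : Function.Periodic f 1) (x : ℝ) :
    f x = f (Int.fract x) := by
  have := hf.sub_int_mul_eq (x := x) ⌊x⌋
  rw [mul_one] at this
  rw [Int.fract, this]

lemma fderiv_ampl_periodic (p m : ℝ) :
    Function.Periodic (fun x => fderiv ℝ ampl (x, p, m)) 1 := by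
  intro x
  have h : (fun q : ℝ × ℝ × ℝ => ampl (q + (1, 0, 0))) = ampl := by
    funext q
    obtain ⟨x, p, m⟩ := q
    simpa using ampl_add_one x p m
  have h1 := fderiv_comp_add_right (𝕜 := ℝ) (f := ampl) (x := (x, p, m)) (1, 0, 0)
  rw [h] at h1
  simpa using h1.symm

/-- Uniform bounds for the amplitude near the degenerate point `p = m = 0`. -/
lemma exists_ampl_bound {p₁ m₁ : ℝ} (hp0 : 0 ≤ p₁) (hp : p₁ < 1) (hm0 : 0 ≤ m₁) (hm : m₁ < 1) :
    ∃ L : ℝ, 0 ≤ L ∧ ∀ x : ℝ, ∀ p ∈ Icc 0 p₁, ∀ m ∈ Icc 0 m₁,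
      ‖fderiv ℝ ampl (x, p, m)‖ ≤ L ∧ ‖ampl (x, p, m)‖ ≤ L * (p + m) := by
  set S : Set (ℝ × ℝ × ℝ) := Icc 0 1 ×ˢ Icc 0 p₁ ×ˢ Icc 0 m₁ with hS
  have hcd : ∀ q ∈ S, ContDiffAt ℝ 1 ampl q := fun q hq =>
    contDiffAt_ampl hq.2.1.1 (hq.2.1.2.trans_lt hp) (hq.2.2.2.trans_lt hm)
  obtain ⟨L, hL⟩ := (isCompact_Icc.prod (isCompact_Icc.prod isCompact_Icc) :
    IsCompact S).exists_bound_of_continuousOn (f := fderiv ℝ ampl)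
    fun q hq => ((hcd q hq).continuousAt_fderiv one_ne_zero).continuousWithinAt
  have hconv : Convex ℝ S := (convex_Icc _ _).prod ((convex_Icc _ _).prod (convex_Icc _ _))
  have hmem : ∀ x : ℝ, ∀ p ∈ Icc 0 p₁, ∀ m ∈ Icc 0 m₁, (Int.fract x, p, m) ∈ S :=
    fun x p hp m hm => ⟨⟨Int.fract_nonneg x, (Int.fract_lt_one x).le⟩, hp, hm⟩
  have h00 := hmem 0 0 (left_mem_Icc.2 hp0) 0 (left_mem_Icc.2 hm0)
  have hL0 : 0 ≤ L := (norm_nonneg _).trans (hL _ h00)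
  refine ⟨L, hL0, fun x p hp m hm => ⟨?_, ?_⟩⟩
  · rw [periodic_fract (fderiv_ampl_periodic p m) x]
    exact hL _ (hmem x p hp m hm)
  · rw [periodic_fract (f := fun x => ampl (x, p, m)) (fun x => ampl_add_one x p m) x]
    -- Mean value inequality from the point `(x, 0, 0)`, where `ampl` vanishes.
    have h1 := hconv.norm_image_sub_le_of_norm_fderiv_le (𝕜 := ℝ) (f := ampl)
      (fun q hq => (hcd q hq).differentiableAt one_ne_zero) hL
      (hmem x 0 (left_mem_Icc.2 hp0) 0 (left_mem_Icc.2 hm0)) (hmem x p hp m hm)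
    rw [ampl_zero, sub_zero] at h1
    refine h1.trans (mul_le_mul_of_nonneg_left ?_ hL0)
    rw [Prod.mk_sub_mk, Prod.mk_sub_mk, Prod.norm_mk, Prod.norm_mk, sub_self, sub_zero, sub_zero,
      norm_zero, Real.norm_of_nonneg hp.1, Real.norm_of_nonneg hm.1]
    have := hp.1
    have := hm.1
    exact max_le (by linarith) (max_le (by linarith) (by linarith))

/-- The nome decays like a power of `κ` as `κ → 0`. -/
lemma nome_le_rpow {b ε : ℝ} (hb : b ∈ Ioo (0 : ℝ) 1)
    (hε : ∀ u ∈ Ioc 0 b, ε ≤ nomeRate (branchParam u)) {u : ℝ} (hu : u ∈ Ioc 0 b) :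
    nome u ≤ nome b * b ^ (-ε) * u ^ ε := by
  have hsub : ∀ x ∈ Ioc 0 b, x ∈ Ioo (0 : ℝ) 1 := fun x hx => ⟨hx.1, hx.2.trans_lt hb.2⟩
  -- The logarithmic derivative of this product is `(nomeRate - ε)/x ≥ 0`, hence it is at most its
  -- value at `b`.
  have hd : ∀ x ∈ Ioc 0 b, HasDerivAt (fun u => nome u * u ^ (-ε))
      (nome x * x ^ (-ε - 1) * (nomeRate (branchParam x) - ε)) x := by
    intro x hx
    refine ((hasDerivAt_nome (hsub x hx)).mul
      (Real.hasDerivAt_rpow_const (p := -ε) (Or.inl hx.1.ne'))).congr_deriv ?_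
    have := hx.1.ne'
    rw [Real.rpow_sub hx.1, Real.rpow_one]
    field_simp
    ring
  have hmono : MonotoneOn (fun u => nome u * u ^ (-ε)) (Ioc 0 b) := by
    refine monotoneOn_of_deriv_nonneg (convex_Ioc 0 b)
      (fun x hx => (hd x hx).continuousAt.continuousWithinAt)
      (fun x hx => (hd x (interior_subset hx)).differentiableAt.differentiableWithinAt)
      fun x hx => ?_
    have hx' := interior_subset hx
    rw [(hd x hx').deriv]
    exact mul_nonneg (mul_nonneg (nome_pos x).le (Real.rpow_nonneg hx'.1.le _))
      (sub_nonneg.2 (hε x hx'))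
  have h := hmono hu (right_mem_Ioc.2 hb.1) hu.2
  simp only at h
  calc nome u = nome u * u ^ (-ε) * u ^ ε := by
        rw [mul_assoc, ← Real.rpow_add hu.1, neg_add_cancel, Real.rpow_zero, mul_one]
    _ ≤ _ := mul_le_mul_of_nonneg_right h (Real.rpow_nonneg hu.1.le _)

/-- The averaging estimate on `0 < u < b`, for every `b < 1`. -/
theorem exists_averaging_bound_M {b : ℝ} (hb : b ∈ Ioo (0 : ℝ) 1) :
    ∃ C : ℝ, ∀ s v : ℝ, 0 < s → 0 < v → v / s < b →
      IntegrableOn (fun t : ℝ => M ((t * freqV (v / t) : ℝ) : ℂ) (v / t) / (t : ℂ)) (Ioi s) ∧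
      IntervalIntegrable (fun u : ℝ => avgM u / (u : ℂ)) volume 0 (v / s) ∧
      ‖(∫ t in Ioi s, M ((t * freqV (v / t) : ℝ) : ℂ) (v / t) / (t : ℂ)) -
        ∫ u in (0 : ℝ)..(v / s), avgM u / (u : ℂ)‖ ≤ C / s := by
  have hsub : ∀ u ∈ Ioc 0 b, u ∈ Ioo (0 : ℝ) 1 := fun u hu => ⟨hu.1, hu.2.trans_lt hb.2⟩
  set m₁ := branchParam b
  have hm₁ : m₁ ∈ Ioo (0 : ℝ) 1 := branchParam_mem hb
  have hmem : ∀ u ∈ Ioc 0 b, branchParam u ∈ Icc 0 m₁ := fun u hu =>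
    ⟨(branchParam_mem (hsub u hu)).1.le,
      strictMonoOn_branchParam.monotoneOn (hsub u hu) hb hu.2⟩
  have hsubI : Icc 0 m₁ ⊆ Iio 1 := fun m hm => hm.2.trans_lt hm₁.2
  have hne : (Icc 0 m₁).Nonempty := nonempty_Icc.2 hm₁.1.le
  have hpos : ∀ {f : ℝ → ℝ}, ContinuousOn f (Iio 1) → (∀ m < 1, 0 < f m) →
      ∃ c > 0, ∀ u ∈ Ioc 0 b, c ≤ f (branchParam u) := by
    intro f hf hf0
    obtain ⟨x, hx, hmin⟩ := isCompact_Icc.exists_isMinOn hne (hf.mono hsubI)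
    exact ⟨f x, hf0 x (hsubI hx), fun u hu => hmin (hmem u hu)⟩
  have hbdd : ∀ {f : ℝ → ℝ}, ContinuousOn f (Iio 1) →
      ∃ C, 0 ≤ C ∧ ∀ u ∈ Ioc 0 b, |f (branchParam u)| ≤ C := by
    intro f hf
    obtain ⟨C, hC⟩ := isCompact_Icc.exists_bound_of_continuousOn (hf.mono hsubI)
    exact ⟨C, (norm_nonneg _).trans (hC _ (left_mem_Icc.2 hm₁.1.le)), fun u hu => hC _ (hmem u hu)⟩
  obtain ⟨r₀, hr₀, hr⟩ := hpos continuousOn_nomeRate fun _ => nomeRate_pos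
  obtain ⟨B₀, hB₀, hB⟩ := hpos continuousOn_paramB fun _ => paramB_pos
  obtain ⟨K₀, hK₀, hK⟩ := hpos continuousOn_paramK fun _ => paramK_pos
  obtain ⟨R₁, hR₁, hR⟩ := hbdd continuousOn_nomeRate
  obtain ⟨K₁, hK₁, hKb⟩ := hbdd continuousOn_paramK
  have hdK : ContinuousOn (fun m => paramB m / (2 * (1 - m)) * (2 / paramK m)) (Iio 1) := by
    refine (continuousOn_paramB.div (by fun_prop) fun m hm => ?_).mul
      (continuousOn_const.div continuousOn_paramK fun m hm => (paramK_pos hm).ne')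
    have : 0 < 1 - m := sub_pos.2 hm
    positivity
  obtain ⟨D₁, hD₁, hD⟩ := hbdd hdK
  -- `r₀` serves the decay of the nome; the cap at `1` gives `u ≤ u ^ ε`, used for `branchParam`.
  set ε := min r₀ 1
  have hε : 0 < ε := lt_min hr₀ one_pos
  have hnome : ∀ u ∈ Ioc 0 b, nome u ≤ nome b * b ^ (-ε) * u ^ ε := fun u hu =>
    nome_le_rpow hb (fun w hw => (min_le_left _ _).trans (hr w hw)) hu
  have hnb : ∀ u ∈ Ioc 0 b, nome u ∈ Icc 0 (nome b) := by
    refine fun u hu => ⟨(nome_pos u).le, (hnome u hu).trans ?_⟩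
    have h1 : u ^ ε ≤ b ^ ε := Real.rpow_le_rpow hu.1.le hu.2 hε.le
    calc nome b * b ^ (-ε) * u ^ ε ≤ nome b * b ^ (-ε) * b ^ ε :=
          mul_le_mul_of_nonneg_left h1
            (mul_nonneg (nome_pos b).le (Real.rpow_nonneg hb.1.le _))
      _ = nome b := by
          rw [mul_assoc, ← Real.rpow_add hb.1, neg_add_cancel, Real.rpow_zero, mul_one]
  have hmb : ∀ u ∈ Ioc 0 b, branchParam u ≤ 1 / B₀ * u ^ ε := by
    intro u hu
    have h1 := branchParam_mul_paramB (hsub u hu)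
    have h2 : u ≤ u ^ ε := by
      have := Real.rpow_le_rpow_of_exponent_ge hu.1 (hsub u hu).2.le (min_le_right r₀ 1)
      rwa [Real.rpow_one] at this
    have h3 : branchParam u * B₀ ≤ u := by
      calc branchParam u * B₀ ≤ branchParam u * paramB (branchParam u) :=
            mul_le_mul_of_nonneg_left (hB u hu) (hmem u hu).1
        _ = u := h1
    rw [one_div_mul_eq_div, le_div_iff₀ hB₀]
    exact h3.trans h2
  obtain ⟨L, hL0, hL⟩ := exists_ampl_bound (nome_pos b).le (nome_lt_one hb) hm₁.1.le hm₁.2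
  set N₁ := nome b * b ^ (-ε)
  have hN₁ : 0 ≤ N₁ := mul_nonneg (nome_pos b).le (Real.rpow_nonneg hb.1.le _)
  -- One summand for each of the bounds on `M`, `u ∂M/∂u`, `k` and `u k'`.
  set A := L * (N₁ + 1 / B₀) + L * (R₁ + 2 / K₀) + K₁ + D₁
  have hA₁ : 0 ≤ L * (N₁ + 1 / B₀) := by positivity
  have hA₂ : 0 ≤ L * (R₁ + 2 / K₀) := by positivity
  have hA : 0 ≤ A := by positivity
  have hIoo : ∀ u ∈ Ioo 0 b, u ∈ Ioc 0 b := fun u hu => Ioo_subset_Ioc_self hu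
  refine exists_averaging_bound (M := fun x u : ℝ => M x u) (A := A) (ε := ε)
    (k := fun u => paramK (branchParam u)) (V := freqV)
    (k' := fun u => paramB (branchParam u) / (2 * (1 - branchParam u)) *
      (2 / paramK (branchParam u)))
    (V' := fun u => 2 / Real.pi * periodRatio u)
    (fun x u hu => contDiffAt_M x (hsub u (hIoo u hu))) ?_ hA hε ?_ ?_ ?_
    (fun u hu => paramK_pos (branchParam_mem (hsub u (hIoo u hu))).2) ?_ ?_
    (fun u hu => hasDerivAt_freqV (hsub u (hIoo u hu)))
    (fun u hu => freqV_sub_mul_deriv (hsub u (hIoo u hu)))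
  · intro u hu x
    simp only
    rw [M_eq_ampl _ (hsub u (hIoo u hu)), M_eq_ampl _ (hsub u (hIoo u hu)), ampl_add_one]
  · intro x u hu
    have hu' := hIoo u hu
    rw [M_eq_ampl _ (hsub u hu')]
    have h0 : 0 ≤ u ^ ε := Real.rpow_nonneg hu.1.le _
    calc ‖ampl (x, nome u, branchParam u)‖ ≤ L * (nome u + branchParam u) :=
          (hL x _ (hnb u hu') _ (hmem u hu')).2
      _ ≤ L * (N₁ * u ^ ε + 1 / B₀ * u ^ ε) :=
          mul_le_mul_of_nonneg_left (add_le_add (hnome u hu') (hmb u hu')) hL0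
      _ = L * (N₁ + 1 / B₀) * u ^ ε := by ring
      _ ≤ A * u ^ ε := mul_le_mul_of_nonneg_right (by simp only [A]; linarith) h0
  · intro x u hu
    have hu' := hIoo u hu
    have hu1 := hsub u hu'
    rw [mul_fderiv_M x hu1]
    have h1 : ‖((0, nome u * nomeRate (branchParam u), u * (2 / paramK (branchParam u))) :
        ℝ × ℝ × ℝ)‖ ≤ R₁ + 2 / K₀ := by
      have hK0 : 0 ≤ 2 / K₀ := by positivity
      rw [Prod.norm_mk, Prod.norm_mk, norm_zero]
      refine max_le (by linarith) (max_le ?_ ?_)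
      · rw [norm_mul, Real.norm_of_nonneg (nome_pos u).le]
        have h2 : nome u * ‖nomeRate (branchParam u)‖ ≤ 1 * R₁ :=
          mul_le_mul (nome_lt_one hu1).le (hR u hu') (norm_nonneg _) zero_le_one
        linarith
      · have hKp := paramK_pos (branchParam_mem hu1).2
        rw [Real.norm_of_nonneg (mul_nonneg hu.1.le (by positivity))]
        have h2 : u * (2 / paramK (branchParam u)) ≤ 1 * (2 / K₀) :=
          mul_le_mul hu1.2.le (div_le_div_of_nonneg_left zero_le_two hK₀ (hK u hu'))
            (by positivity) zero_le_one
        linarith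
    refine (ContinuousLinearMap.le_opNorm _ _).trans ?_
    refine (mul_le_mul (hL x _ (hnb u hu') _ (hmem u hu')).1 h1 (norm_nonneg _) hL0).trans ?_
    simp only [A]
    linarith
  · intro u hu
    have hu1 := hsub u (hIoo u hu)
    exact (hasDerivAt_paramK (branchParam_mem hu1).2).comp u (hasDerivAt_branchParam hu1)
  · intro u hu
    have := (le_abs_self _).trans (hKb u (hIoo u hu))
    simp only [A]
    linarith
  · intro u hu
    have hu' := hIoo u hu
    rw [abs_mul, abs_of_pos hu.1]
    have h2 := mul_le_mul (hsub u hu').2.le (hD u hu') (abs_nonneg _) zero_le_one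
    simp only [A]
    linarith

end SineKernel

end

theorem proposition1 (δ : ℝ) (hδ : δ ∈ Set.Ioo (0 : ℝ) 1) (s₀ : ℝ) (hs₀ : 0 < s₀) :
    (∀ u ∈ Set.Ioc (0 : ℝ) (1 - δ),
      IntervalIntegrable (fun x : ℝ => SineKernel.M (x : ℂ) u) MeasureTheory.volume 0 1) ∧
    ∃ C : ℝ, ∀ s v : ℝ, s₀ ≤ s → 0 < v → v ≤ s * (1 - δ) →
      MeasureTheory.IntegrableOn
        (fun t : ℝ => SineKernel.M ((t * SineKernel.freqV (v / t) : ℝ) : ℂ) (v / t) / (t : ℂ))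
        (Set.Ioi s) MeasureTheory.volume ∧
      IntervalIntegrable (fun u : ℝ => SineKernel.avgM u / (u : ℂ))
        MeasureTheory.volume 0 (v / s) ∧
      ‖(∫ t in Set.Ioi s,
            SineKernel.M ((t * SineKernel.freqV (v / t) : ℝ) : ℂ) (v / t) / (t : ℂ)) -
          ∫ u in (0 : ℝ)..(v / s), SineKernel.avgM u / (u : ℂ)‖ ≤ C / s := by
  constructor
  · intro u hu
    have hu1 : u ∈ Set.Ioo (0 : ℝ) 1 := ⟨hu.1, by linarith [hu.2, hδ.1]⟩
    refine Continuous.intervalIntegrable (continuous_iff_continuousAt.2 fun x => ?_) _ _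
    exact ContinuousAt.comp (f := fun x : ℝ => (x, u)) (SineKernel.contDiffAt_M x hu1).continuousAt
      (by fun_prop)
  -- The averaging bound needs `v / s < b` strictly, and `v / s` may equal `1 - δ`.
  · obtain ⟨C, hC⟩ := SineKernel.exists_averaging_bound_M (b := 1 - δ / 2)
      ⟨by linarith [hδ.2], by linarith [hδ.1]⟩
    refine ⟨C, fun s v hs hv hvs => hC s v (hs₀.trans_le hs) hv ?_⟩
    have hs' : 0 < s := hs₀.trans_le hs
    rw [div_lt_iff₀ hs']
    nlinarith [hδ.1]
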